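/- All matroids are finite. A matroid $M$ on a ground set $E$ is a positroid if, for some linear ordering of $E$, it is represented by a full-rank real matrix, with columns indexed by $E$ in this order, all of whose maximal minors are nonnegative. If $E(M)\cap E(N)=\{e\}$, the parallel connection $P_e(M,N)$ is the matroid on $E(M)\cup E(N)$ whose flats are the sets $F\subseteq E(M)\cup E(N)$ such that $F\cap E(M)$ is a flat of $M$ and $F\cap E(N)$ is a flat of $N$. For $\ell\ge 1$ let $\mathcal M_{2,\ell}$ be the class of matroids isomorphic to the rank-$2$ uniform matroid $U_{2,\ell+1}$ on $\ell+1$ elements, and for $r\ge 3$ let $\mathcal M_{r,\ell}$ be the class of all parallel connections $P_e(M,N)$ with $M\in\mathcal M_{r-1,\ell}$, $N\cong U_{2,\ell+1}$ and $E(M)\cap E(N)=\{e\}$; thus $\mathcal M_{r,\ell}$ consists of the matroids obtained by taking parallel connections of $r-1$ copies of $U_{2,\ell+1}$. **Theorem.** Let $r,\ell\ge 1$ be integers. Every simple rank-$r$ positroid $M$ with no minor isomorphic to $U_{2,\ell+2}$ has at most $\ell(r-1)+1$ elements. Moreover, if $r\ge 2$, then a matroid $M$ is a simple rank-$r$ positroid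 with no minor isomorphic to $U_{2,\ell+2}$ and with exactly $\ell(r-1)+1$ elements if and only if $M\in\mathcal M_{r,\ell}$. -/

import Mathlib

namespace PositroidExtremal

/-- A matroid is simple if every set of at most two elements of its ground set is independent
(the case `e = f` says that there are no loops). -/
def IsSimple {α : Type*} (M : Matroid α) : Prop :=
  ∀ e ∈ M.E, ∀ f ∈ M.E, M.Indep {e, f}

/-- `M` is (isomorphic to) the rank-two uniform matroid `U_{2,n}`: the ground set has `n` elements,
and the independent sets are the sets of at most two elements. -/
def IsUniformTwo {α : Type*} (M : Matroid α) (n : ℕ) : Prop :=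
  M.E.encard = n ∧ ∀ I : Set α, M.Indep I ↔ I ⊆ M.E ∧ I.encard ≤ 2

/-- `M` has a minor isomorphic to `U_{2,n}`. -/
def HasUniformTwoMinor {α : Type*} (M : Matroid α) (n : ℕ) : Prop :=
  ∃ N : Matroid α, N.IsMinor M ∧ IsUniformTwo N n

/-- `M` is a positroid: for some linear ordering `φ 0, …, φ (n - 1)` of the ground set, it is
represented by a full-rank real `k × n` matrix all of whose maximal (that is, `k × k`) minors,
taken with the columns in increasing order, are nonnegative. -/
def IsPositroid {α : Type*} (M : Matroid α) : Prop :=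
  ∃ (k n : ℕ) (A : Matrix (Fin k) (Fin n) ℝ) (φ : Fin n → α),
    Function.Injective φ ∧ Set.range φ = M.E ∧
    (∀ J : Set (Fin n), M.Indep (φ '' J) ↔ LinearIndepOn ℝ (fun j => A.col j) J) ∧
    A.rank = k ∧
    ∀ c : Fin k ↪o Fin n, 0 ≤ (A.submatrix id c).det

/-- `P` is the parallel connection `P_e(M, N)` of `M` and `N` with basepoint `e`: the ground sets of
`M` and `N` meet exactly in `e`, and `P` is the matroid on their union whose flats are the
sets that meet each of the two ground sets in a flat. (A matroid is determined by its
ground set and its flats.) -/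
structure IsParallelConnection {α : Type*} (P M N : Matroid α) (e : α) : Prop where
  inter_ground : M.E ∩ N.E = {e}
  ground_eq : P.E = M.E ∪ N.E
  isFlat_iff : ∀ F : Set α,
    P.IsFlat F ↔ F ⊆ M.E ∪ N.E ∧ M.IsFlat (F ∩ M.E) ∧ N.IsFlat (F ∩ N.E)

/-- `IsParallelConnectionOfLines ℓ r M`: `M` can be obtained by taking parallel connections of
`r - 1` copies of `U_{2,ℓ+1}`. For `r = 2` these are the matroids isomorphic to `U_{2,ℓ+1}`; those
for `r + 1` are the parallel connections, at any common element, of one for `r`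
with a matroid isomorphic to `U_{2,ℓ+1}`. -/
inductive IsParallelConnectionOfLines {α : Type*} (ℓ : ℕ) : ℕ → Matroid α → Prop
  | line {M : Matroid α} (hM : IsUniformTwo M (ℓ + 1)) : IsParallelConnectionOfLines ℓ 2 M
  | connect {r : ℕ} {P M N : Matroid α} {e : α} (hM : IsParallelConnectionOfLines ℓ r M)
      (hN : IsUniformTwo N (ℓ + 1)) (hP : IsParallelConnection P M N e) :
      IsParallelConnectionOfLines ℓ (r + 1) P

end PositroidExtremal

/-! The geometric core is that long lines (at least three elements) of a simple positroid are
pairwise non-crossing in the cyclic order of the ground set. In a rank-two contraction, a parallel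
class `{a, c}` cannot be separated by two elements `b`, `d` outside it: the four minors pairing `a`
or `c` with `b` or `d` would have a strictly negative product (`PosRep.false_of_crosses`). A third
element on a line makes two of its elements parallel after contraction, which gives
`PosRep.eq_of_crosses`.

A long line of smallest spread therefore has an inner element `e` on no other long line
(`PosRep.exists_unique_long`). Let `L` be the only line through `e` that may be long. Contracting
`e` and keeping one element of `L \ {e}` gives a simple positroid of rank one less with `|L| - 1 ≤
ℓ` fewer elements. Induction yields the bound (`Admissible.ncard_le`).

If the bound is attained, the simplified contraction attains it too, hence is a parallel connection
of lines by induction. It has a leaf: `ℓ` elements `Y`, chosen off `L`, whose complement is a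
hyperplane. In the matroid itself `Y` is again complementary to a hyperplane, and non-crossing in
the plane of `Y` and `e` shows that `Y` with one more element `g` is a line
(`Admissible.exists_isLine_insert`). The matroid is then the parallel connection at `g` of that line
and the hyperplane, which is extremal, and induction applies once more.

Conversely, attaching a line keeps the matroid a positroid: the new elements are inserted directly
after the base point, in a pencil through its vector (`PosRep.parallel`). No longer line arises in a
minor, since a line in a contraction can be moved into one side or counted
(`IsParallelConnection.not_hasUniformTwoMinor`). -/

namespace PositroidExtremal

open Set Matroid

variable {α : Type*} {M N P : Matroid α} {L L' J X Y H : Set α} {a b c d e f x y z : α}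
  {k ℓ n r : ℕ} {pos : α → ℤ} {v : α → Fin k → ℝ}

/-! ### Simple matroids and their lines -/

lemma IsSimple.closure_empty (hM : IsSimple M) : M.closure ∅ = ∅ := by
  refine eq_empty_of_forall_notMem fun x hx ↦ ?_
  have hxE := mem_ground_of_mem_closure hx
  have h := hM x hxE x hxE
  rw [pair_eq_singleton, ← insert_empty_eq, M.empty_indep.insert_indep_iff_of_notMem (by simp)] at h
  exact h.2 hx

lemma IsSimple.closure_singleton (hM : IsSimple M) (hx : x ∈ M.E) : M.closure {x} = {x} := by
  refine subset_antisymm (fun y hy ↦ ?_) (M.subset_closure {x} (by simpa))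
  by_contra hne
  have h := hM y (mem_ground_of_mem_closure hy) x hx
  rw [Indep.insert_indep_iff_of_notMem (h.subset (by simp)) hne] at h
  exact h.2 hy

lemma isSimple_of_closure (h0 : M.closure ∅ = ∅) (h1 : ∀ x ∈ M.E, M.closure {x} = {x}) :
    IsSimple M := by
  intro e he f hf
  have hf' : M.Indep {f} := by
    rw [← insert_empty_eq, M.empty_indep.insert_indep_iff_of_notMem (by simp), h0]
    exact ⟨hf, by simp⟩
  by_cases hef : e = f
  · simpa [hef] using hf'
  · rw [hf'.insert_indep_iff_of_notMem (by simpa), h1 f hf]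
    exact ⟨he, by simpa⟩

lemma IsSimple.restrict (hM : IsSimple M) (hX : X ⊆ M.E) : IsSimple (M ↾ X) := by
  intro e he f hf
  exact (hM e (hX he) f (hX hf)).indep_restrict_of_subset (by simp_all [insert_subset_iff])

lemma IsSimple.closure_pair_congr (hM : IsSimple M) (hx : x ∈ M.E)
    (hz : z ∈ M.closure {x, y}) (hzx : z ≠ x) : M.closure {x, z} = M.closure {x, y} := by
  rw [pair_comm x z, pair_comm x y]
  refine closure_insert_congr ⟨by rwa [pair_comm], ?_⟩
  rwa [hM.closure_singleton hx]

/-- A line of a matroid: the closure of two distinct elements. -/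
def IsLine (M : Matroid α) (L : Set α) : Prop :=
  ∃ x ∈ M.E, ∃ y ∈ M.E, x ≠ y ∧ L = M.closure {x, y}

/-- A line with at least three elements. -/
def IsLongLine (M : Matroid α) (L : Set α) : Prop :=
  IsLine M L ∧ ∀ a b : α, ∃ c ∈ L, c ≠ a ∧ c ≠ b

lemma isLine_closure_pair (hx : x ∈ M.E) (hy : y ∈ M.E) (hxy : x ≠ y) :
    IsLine M (M.closure {x, y}) := ⟨x, hx, y, hy, hxy, rfl⟩

lemma IsLine.subset_ground (hL : IsLine M L) : L ⊆ M.E := by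
  obtain ⟨x, -, y, -, -, rfl⟩ := hL
  exact M.closure_subset_ground _

lemma IsLine.isFlat (hL : IsLine M L) : M.IsFlat L := by
  obtain ⟨x, -, y, -, -, rfl⟩ := hL
  exact isFlat_closure _

lemma IsLine.eq_closure (hM : IsSimple M) (hL : IsLine M L) (hx : x ∈ L) (hy : y ∈ L)
    (hxy : x ≠ y) : L = M.closure {x, y} := by
  have hLE := hL.subset_ground
  obtain ⟨p, hp, q, hq, hpq, rfl⟩ := hL
  by_cases hxp : x = p
  · subst hxp
    exact (hM.closure_pair_congr hp hy hxy.symm).symm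
  · have h1 : M.closure {p, x} = M.closure {p, q} := hM.closure_pair_congr hp hx hxp
    rw [← h1, pair_comm] at hy ⊢
    exact (hM.closure_pair_congr (hLE hx) hy hxy.symm).symm

lemma IsLine.eq_of_mem (hM : IsSimple M) (hL : IsLine M L) (hL' : IsLine M L') (hx : x ∈ L)
    (hy : y ∈ L) (hx' : x ∈ L') (hy' : y ∈ L') (hxy : x ≠ y) : L = L' := by
  rw [hL.eq_closure hM hx hy hxy, hL'.eq_closure hM hx' hy' hxy]

lemma IsLine.eRk (hM : IsSimple M) (hL : IsLine M L) : M.eRk L = 2 := by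
  obtain ⟨p, hp, q, hq, hpq, rfl⟩ := hL
  rw [eRk_closure_eq, (hM p hp q hq).eRk_eq_encard, encard_pair hpq]

lemma isLongLine_of_mem (hL : IsLine M L) (ha : a ∈ L) (hb : b ∈ L) (hc : c ∈ L)
    (hab : a ≠ b) (hac : a ≠ c) (hbc : b ≠ c) : IsLongLine M L := by
  refine ⟨hL, fun p q ↦ ?_⟩
  by_cases h1 : a ≠ p ∧ a ≠ q
  · exact ⟨a, ha, h1⟩
  by_cases h2 : b ≠ p ∧ b ≠ q
  · exact ⟨b, hb, h2⟩
  exact ⟨c, hc, by grind⟩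

lemma IsLine.isLongLine_of_encard (hL : IsLine M L) (h : 3 ≤ L.encard) : IsLongLine M L := by
  refine ⟨hL, fun p q ↦ ?_⟩
  by_contra! hcon
  have : L ⊆ {p, q} := fun c hc ↦ by
    by_cases hcp : c = p
    · simp [hcp]
    · simp [hcon c hc hcp]
  have h2 := (h.trans (encard_le_encard this)).trans (encard_insert_le _ _)
  rw [encard_singleton] at h2
  exact absurd h2 (by norm_num)

/-! ### Rank-two uniform restrictions and minors -/

lemma isUniformTwo_restrict (hM : IsSimple M) {S : Set α} (hS : S ⊆ M.E) (hr : M.eRk S ≤ 2)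
    {n : ℕ} (hn : S.encard = n) : IsUniformTwo (M ↾ S) n := by
  refine ⟨hn, fun I ↦ ⟨fun h ↦ ?_, fun ⟨hIS, hI⟩ ↦ ?_⟩⟩
  · rw [restrict_indep_iff] at h
    refine ⟨h.2, ?_⟩
    rw [← h.1.eRk_eq_encard]
    exact (M.eRk_mono h.2).trans hr
  · rw [restrict_indep_iff]
    refine ⟨?_, hIS⟩
    have hIS : I ⊆ S := hIS
    obtain rfl | ⟨p, hp⟩ := I.eq_empty_or_nonempty
    · exact M.empty_indep
    by_cases h1 : ∃ q ∈ I, q ≠ p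
    · obtain ⟨q, hq, hqp⟩ := h1
      have h2 : I.encard ≤ ({p, q} : Set α).encard := by
        rw [encard_pair hqp.symm]
        exact hI
      have hpq : {p, q} ⊆ I := insert_subset hp (singleton_subset_iff.2 hq)
      have heq : {p, q} = I := Finite.eq_of_subset_of_encard_le (toFinite _) hpq h2
      rw [← heq]
      exact hM p (hS (hIS hp)) q (hS (hIS hq))
    · push Not at h1
      exact (hM p (hS (hIS hp)) p (hS (hIS hp))).subset fun q hq ↦ by simp [h1 q hq]

lemma IsLine.encard_le (hM : IsSimple M) {m : ℕ} (hU : ¬ HasUniformTwoMinor M (m + 1))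
    (hL : IsLine M L) : L.encard ≤ m := by
  by_contra! h
  have h' : ((m + 1 : ℕ) : ℕ∞) ≤ L.encard := by
    push_cast
    exact Order.add_one_le_of_lt h
  obtain ⟨S, hSL, hS⟩ := exists_subset_encard_eq h'
  have hSE := hSL.trans hL.subset_ground
  refine hU ⟨M ↾ S, (IsRestriction.exists_eq_delete (restrict_isRestriction M S hSE)).elim
    fun D hD ↦ ⟨∅, D, by simpa using hD.2⟩, isUniformTwo_restrict hM hSE ?_ hS⟩
  exact (M.eRk_mono hSL).trans (hL.eRk hM).le

lemma HasUniformTwoMinor.of_isMinor {n : ℕ} (h : HasUniformTwoMinor N n) (hNM : N ≤m M) :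
    HasUniformTwoMinor M n := by
  obtain ⟨U, hU, hU2⟩ := h
  exact ⟨U, hU.trans hNM, hU2⟩

lemma restrict_isMinor (hX : X ⊆ M.E) : (M ↾ X) ≤m M := by
  obtain ⟨D, -, hD⟩ := (restrict_isRestriction M X hX).exists_eq_delete
  exact ⟨∅, D, by simpa using hD⟩

lemma contract_restrict_isMinor {C : Set α} (hX : X ⊆ M.E \ C) : ((M ／ C) ↾ X) ≤m M := by
  obtain ⟨D, -, hD⟩ := (restrict_isRestriction (M ／ C) X (by simpa)).exists_eq_delete
  exact ⟨C, D, hD⟩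

/-! ### Parallel connections through their flats -/

lemma IsParallelConnection.symm (h : IsParallelConnection P M N e) :
    IsParallelConnection P N M e where
  inter_ground := by rw [inter_comm, h.inter_ground]
  ground_eq := by rw [union_comm, h.ground_eq]
  isFlat_iff F := by rw [h.isFlat_iff, union_comm]; tauto

/-- Every flat of `M` is the trace of a flat of `P`: add all of `N.E` if it contains `e`, and only
the loops of `N` otherwise. The second choice does not introduce `e`, because `e` is not a loop of
`N`. -/
lemma IsParallelConnection.restrict_left (h : IsParallelConnection P M N e)
    (he : e ∉ N.closure ∅) : P ↾ M.E = M := by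
  have hE : M.E ⊆ P.E := h.ground_eq ▸ subset_union_left
  have heMN : e ∈ M.E ∩ N.E := h.inter_ground ▸ mem_singleton e
  refine ext_closure fun Y ↦ ?_
  rw [← closure_inter_ground, ← M.closure_inter_ground]
  generalize hZ : Y ∩ M.E = Z
  have hZM : Z ⊆ M.E := hZ ▸ inter_subset_right
  rw [restrict_ground_eq, hZ, restrict_closure_eq _ hZM hE]
  refine subset_antisymm ?_ ?_
  · have key : ∃ F, P.IsFlat F ∧ F ∩ M.E = M.closure Z := by
      by_cases heZ : e ∈ M.closure Z
      · refine ⟨M.closure Z ∪ N.E, (h.isFlat_iff _).2 ⟨?_, ?_⟩, ?_⟩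
        · exact union_subset_union_left _ (M.closure_subset_ground _)
        · have : (M.closure Z ∪ N.E) ∩ M.E = M.closure Z := by
            have h2 := M.closure_subset_ground Z
            have h3 := h.inter_ground
            ext x
            have h4 : x ∈ M.E → x ∈ N.E → x = e := fun h5 h6 ↦ by
              have : x ∈ M.E ∩ N.E := ⟨h5, h6⟩
              simpa [h3] using this
            have := @h2 x
            grind
          refine ⟨by rw [this]; exact isFlat_closure _, ?_⟩
          rw [inter_eq_right.2 subset_union_right]
          exact N.ground_isFlat
        · have h2 := M.closure_subset_ground Z
          have h3 := h.inter_ground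
          ext x
          have h4 : x ∈ M.E → x ∈ N.E → x = e := fun h5 h6 ↦ by
            have : x ∈ M.E ∩ N.E := ⟨h5, h6⟩
            simpa [h3] using this
          have := @h2 x
          grind
      · have h2 := M.closure_subset_ground Z
        have h2' := N.closure_subset_ground ∅
        have h4 : ∀ x, x ∈ M.E → x ∈ N.E → x = e := fun x h5 h6 ↦ by
          have : x ∈ M.E ∩ N.E := ⟨h5, h6⟩
          simpa [h.inter_ground] using this
        have e1 : (M.closure Z ∪ N.closure ∅) ∩ M.E = M.closure Z := by
          ext x
          have := @h2 x
          have := @h2' x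
          have := h4 x
          grind
        have e2 : (M.closure Z ∪ N.closure ∅) ∩ N.E = N.closure ∅ := by
          ext x
          have := @h2 x
          have := @h2' x
          have := h4 x
          grind
        refine ⟨M.closure Z ∪ N.closure ∅, (h.isFlat_iff _).2 ⟨?_, ?_, ?_⟩, e1⟩
        · exact union_subset_union h2 h2'
        · rw [e1]; exact isFlat_closure _
        · rw [e2]; exact isFlat_closure _
    obtain ⟨F, hF, hFZ⟩ := key
    rw [← hFZ]
    refine inter_subset_inter_left _ ?_
    rw [← hF.closure]
    refine P.closure_subset_closure fun x hx ↦ ?_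
    have := M.subset_closure Z hZM hx
    rw [← hFZ] at this
    exact this.1
  · have h1 := ((h.isFlat_iff _).1 (P.isFlat_closure Z)).2.1
    rw [← h1.closure]
    exact M.closure_subset_closure (subset_inter (P.subset_closure Z (hZM.trans hE)) hZM)

lemma IsParallelConnection.unique {Q : Matroid α} (h : IsParallelConnection P M N e)
    (h' : IsParallelConnection Q M N e) : P = Q := by
  refine ext_closure fun X ↦ ?_
  rw [closure_def, closure_def, h.ground_eq, h'.ground_eq]
  simp_rw [h.isFlat_iff, h'.isFlat_iff]

/-- The recognition criterion for parallel connections with a line. A set `F` that is a flat on both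
sides meets `K` in at most one element or contains `K`. By exchange, an element of `K \ H` added to
a flat inside `H` spans nothing new in `H`, and if the closure of `F` reached a second element of
`K` it would contain `g`. -/
lemma isParallelConnection_restrict {H K : Set α} {g : α} (hHK : H ∪ K = M.E)
    (hg : H ∩ K = {g}) (hH : M.IsFlat H)
    (hK : ∀ x ∈ K, ∀ y ∈ K, x ≠ y → K ⊆ M.closure {x, y}) :
    IsParallelConnection M (M ↾ H) (M ↾ K) g := by
  have hHE := hH.subset_ground
  have hKE : K ⊆ M.E := hHK ▸ subset_union_right
  have hgHK : g ∈ H ∩ K := hg ▸ mem_singleton g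
  have huniq : ∀ x, x ∈ H → x ∈ K → x = g := fun x h1 h2 ↦ by
    have : x ∈ H ∩ K := ⟨h1, h2⟩
    simpa [hg] using this
  have hres : ∀ {F Y : Set α}, Y ⊆ M.E → M.IsFlat F → (M ↾ Y).IsFlat (F ∩ Y) := by
    intro F Y hY hF
    rw [isFlat_iff_closure_eq, restrict_closure_eq _ inter_subset_right hY]
    refine subset_antisymm (inter_subset_inter_left _ ?_) (subset_inter
      (M.subset_closure _ (inter_subset_right.trans hY)) inter_subset_right)
    exact (M.closure_subset_closure inter_subset_left).trans hF.closure.subset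
  refine ⟨hg, hHK.symm, fun F ↦ ⟨fun hF ↦ ?_, fun ⟨hFE, hFH, hFK⟩ ↦ ?_⟩⟩
  · exact ⟨hF.subset_ground.trans hHK.symm.subset, hres hHE hF, hres hKE hF⟩
  simp only [restrict_ground_eq] at hFE hFH hFK
  have hFE' : F ⊆ M.E := hFE.trans hHK.subset
  have hFH' : M.closure (F ∩ H) = F ∩ H := by
    have h1 := hFH.closure
    rw [restrict_closure_eq _ inter_subset_right hHE, inter_eq_left.2] at h1
    · exact h1
    · exact (M.closure_subset_closure inter_subset_right).trans hH.closure.subset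
  -- adding an element of `K \ H` to a flat inside `H` adds nothing in `H`
  have hadd : ∀ {y z : α}, y ∈ K → y ≠ g → z ∈ H → z ∈ M.closure (insert y (F ∩ H)) →
      z ∈ F := by
    intro y z hy hyg hz hzc
    by_contra hzF
    have h1 := (closure_exchange (M := M) (X := F ∩ H) ⟨hzc, by rw [hFH']; exact fun h ↦ hzF h.1⟩).1
    have h2 : y ∈ H := by
      rw [← hH.closure]
      exact M.closure_subset_closure (insert_subset hz inter_subset_right) h1
    exact hyg (huniq y h2 hy)
  rw [isFlat_iff_closure_eq]
  by_cases hKg : ∃ y ∈ F ∩ K, y ≠ g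
  swap
  · push Not at hKg
    have : F = F ∩ H := by
      ext x
      refine ⟨fun hx ↦ ⟨hx, ?_⟩, fun h ↦ h.1⟩
      rcases hFE hx with h | h
      · exact h
      · exact hKg x ⟨hx, h⟩ ▸ hgHK.1
    rw [this, hFH']
  obtain ⟨y, ⟨hyF, hyK⟩, hyg⟩ := hKg
  by_cases hKF : K ⊆ F
  · refine subset_antisymm (fun z hz ↦ ?_) (M.subset_closure F hFE')
    rcases hHK.symm.subset (M.closure_subset_ground _ hz) with hzH | hzK
    · refine hadd hyK hyg hzH (M.closure_subset_closure_of_subset_closure ?_ hz)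
      intro x hx
      rcases hFE hx with h | h
      · exact M.mem_closure_of_mem' (Or.inr ⟨hx, h⟩)
      · refine M.closure_subset_closure ?_ (hK y hyK g hgHK.2 hyg h)
        have : g ∈ F ∩ H := ⟨hKF hgHK.2, hgHK.1⟩
        exact insert_subset (Or.inl rfl) (singleton_subset_iff.2 (Or.inr this))
    · exact hKF hzK
  · have hone : ∀ x ∈ F, x ∈ K → x = y := by
      intro x hx hxK
      by_contra hxy
      refine hKF fun w hw ↦ ?_
      have h1 : w ∈ (M ↾ K).closure (F ∩ K) := by
        rw [restrict_closure_eq _ inter_subset_right hKE]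
        refine ⟨M.closure_subset_closure ?_ (hK x hxK y hyK hxy hw), hw⟩
        exact insert_subset ⟨hx, hxK⟩ (singleton_subset_iff.2 ⟨hyF, hyK⟩)
      rw [hFK.closure] at h1
      exact h1.1
    have hF : F ⊆ insert y (F ∩ H) := fun x hx ↦ by
      rcases hFE hx with h | h
      · exact Or.inr ⟨hx, h⟩
      · exact Or.inl (hone x hx h)
    refine subset_antisymm (fun z hz ↦ ?_) (M.subset_closure F hFE')
    by_cases hzH : z ∈ H
    · exact hadd hyK hyg hzH (M.closure_subset_closure hF hz)
    have hzK : z ∈ K := (hHK.symm.subset (M.closure_subset_ground _ hz)).resolve_left hzH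
    by_cases hzy : z = y
    · exact hzy ▸ hyF
    have hgcl : g ∈ M.closure F := by
      refine M.closure_subset_closure_of_subset_closure ?_ (hK y hyK z hzK (Ne.symm hzy) hgHK.2)
      exact insert_subset (M.mem_closure_of_mem' hyF) (singleton_subset_iff.2 hz)
    have hgF : g ∈ F := hadd hyK hyg hgHK.1 (M.closure_subset_closure hF hgcl)
    exact absurd (hone g hgF hgHK.2).symm hyg

/-! ### Sign-corrected minors and positroid representations -/

/-- The Vandermonde determinant `∏ i < j, (p j - p i)` of a sequence of integers. Its sign is the
sign of the permutation that sorts the sequence. -/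
noncomputable def vdm (p : Fin k → ℤ) : ℝ := (Matrix.vandermonde fun i => (p i : ℝ)).det

lemma comp_vecCons {β γ : Type*} (f : β → γ) (x : β) (s : Fin k → β) :
    f ∘ Matrix.vecCons x s = Matrix.vecCons (f x) (f ∘ s) := by
  ext i
  exact Fin.cases rfl (fun _ ↦ rfl) i

lemma vdm_vecCons (t : ℤ) (p : Fin k → ℤ) :
    vdm (Matrix.vecCons t p) = (∏ j, ((p j : ℝ) - t)) * vdm p := by
  simp [vdm, Matrix.det_vandermonde, Fin.prod_univ_succ, Fin.prod_Ioi_succ]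

lemma vdm_comp_perm (p : Fin k → ℤ) (σ : Equiv.Perm (Fin k)) :
    vdm (p ∘ σ) = (Equiv.Perm.sign σ : ℤ) * vdm p := by
  rw [vdm, vdm, ← Matrix.det_permute]
  rfl

lemma vdm_pos {p : Fin k → ℤ} (hp : StrictMono p) : 0 < vdm p := by
  rw [vdm, Matrix.det_vandermonde]
  refine Finset.prod_pos fun i _ ↦ Finset.prod_pos fun j hj ↦ ?_
  have := hp (Finset.mem_Ioi.1 hj)
  rw [sub_pos]
  exact_mod_cast this

lemma vdm_eq_zero {p : Fin k → ℤ} (hp : ¬ Function.Injective p) : vdm p = 0 := by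
  contrapose! hp
  rw [vdm, Matrix.det_vandermonde_ne_zero_iff] at hp
  exact fun i j h ↦ hp (by simp [h])

lemma vdm_ne_zero {p : Fin k → ℤ} (hp : Function.Injective p) : vdm p ≠ 0 := by
  rw [vdm, Matrix.det_vandermonde_ne_zero_iff]
  exact fun i j h ↦ hp (Int.cast_injective h)

/-- Stretching all positions makes room for new elements between old ones without changing any sign.
-/
lemma exists_vdm_mul (N : ℤ) (hN : 0 < N) (k : ℕ) :
    ∃ κ : ℝ, 0 < κ ∧ ∀ p : Fin k → ℤ, vdm (fun i ↦ N * p i) = κ * vdm p := by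
  refine ⟨∏ i : Fin k, ∏ _j ∈ Finset.Ioi i, (N : ℝ), ?_, fun p ↦ ?_⟩
  · exact Finset.prod_pos fun i _ ↦ Finset.prod_pos fun j _ ↦ by exact_mod_cast hN
  · simp_rw [vdm, Matrix.det_vandermonde, ← Finset.prod_mul_distrib]
    push_cast
    simp_rw [mul_sub]

/-- The data of a positroid, independent of any sorting: `v` represents `M` with full rank, `pos`
orders the ground set, and the maximal minors of `v`, with their sign corrected by the order of the
columns, all have the same sign. -/
structure PosRep (M : Matroid α) (k : ℕ) (pos : α → ℤ) (v : α → Fin k → ℝ) : Prop where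
  injOn : InjOn pos M.E
  indep_iff : ∀ I ⊆ M.E, (M.Indep I ↔ LinearIndepOn ℝ v I)
  span_eq : Submodule.span ℝ (v '' M.E) = ⊤
  nonneg : ∃ δ : ℝ, δ ≠ 0 ∧ ∀ s : Fin k → α, (∀ i, s i ∈ M.E) →
    0 ≤ δ * (vdm (pos ∘ s) * (Matrix.of (v ∘ s)).det)

/-- Both factors change by the sign of the permutation. Hence sign conditions can be stated for
unsorted tuples, and any chosen element may be moved to the front. -/
lemma vdm_mul_det_comp_perm (pos : α → ℤ) (v : α → Fin k → ℝ) (s : Fin k → α)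
    (σ : Equiv.Perm (Fin k)) :
    vdm (pos ∘ (s ∘ σ)) * (Matrix.of (v ∘ (s ∘ σ))).det =
      vdm (pos ∘ s) * (Matrix.of (v ∘ s)).det := by
  have h1 : vdm (pos ∘ (s ∘ σ)) = _ := vdm_comp_perm (pos ∘ s) σ
  have h2 : (Matrix.of (v ∘ (s ∘ σ))).det = _ := Matrix.det_permute σ (Matrix.of (v ∘ s))
  rw [h1, h2]
  rcases Int.units_eq_one_or (Equiv.Perm.sign σ) with h | h <;> simp [h]

lemma mem_closure_iff_mem_span_of_indep (h : ∀ I ⊆ M.E, (M.Indep I ↔ LinearIndepOn ℝ v I))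
    {I : Set α} (hI : M.Indep I) (hx : x ∈ M.E) :
    x ∈ M.closure I ↔ v x ∈ Submodule.span ℝ (v '' I) := by
  have hIE := hI.subset_ground
  by_cases hxI : x ∈ I
  · exact iff_of_true (M.mem_closure_of_mem hxI) (Submodule.subset_span (mem_image_of_mem v hxI))
  have h1 := h (insert x I) (insert_subset hx hIE)
  rw [linearIndepOn_insert hxI, hI.insert_indep_iff_of_notMem hxI,
    ← h I hIE, and_iff_right hI, mem_sdiff, and_iff_right hx] at h1
  exact not_iff_not.1 h1

lemma mem_closure_iff_mem_span (h : ∀ I ⊆ M.E, (M.Indep I ↔ LinearIndepOn ℝ v I)) (hX : X ⊆ M.E)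
    (hx : x ∈ M.E) : x ∈ M.closure X ↔ v x ∈ Submodule.span ℝ (v '' X) := by
  obtain ⟨I, hI⟩ := M.exists_isBasis X
  have hsp : Submodule.span ℝ (v '' I) = Submodule.span ℝ (v '' X) := by
    refine le_antisymm (Submodule.span_mono (image_mono hI.subset)) (Submodule.span_le.2 ?_)
    rintro _ ⟨y, hy, rfl⟩
    exact (mem_closure_iff_mem_span_of_indep h hI.indep (hX hy)).1 (hI.subset_closure hy)
  rw [← hsp, ← hI.closure_eq_closure]
  exact mem_closure_iff_mem_span_of_indep h hI.indep hx

namespace PosRep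

lemma mem_closure_iff (h : PosRep M k pos v) (hX : X ⊆ M.E)
    (hx : x ∈ M.E) : x ∈ M.closure X ↔ v x ∈ Submodule.span ℝ (v '' X) :=
  mem_closure_iff_mem_span h.indep_iff hX hx

lemma restrict (h : PosRep M k pos v) (hX : M.Spanning X) : PosRep (M ↾ X) k pos v where
  injOn := h.injOn.mono hX.subset_ground
  indep_iff I hI := by
    have hI : I ⊆ X := hI
    rw [restrict_indep_iff, and_iff_left hI, h.indep_iff I (hI.trans hX.subset_ground)]
  span_eq := by
    rw [restrict_ground_eq, eq_top_iff, ← h.span_eq, Submodule.span_le]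
    rintro _ ⟨y, hy, rfl⟩
    rw [SetLike.mem_coe, ← h.mem_closure_iff hX.subset_ground hy, hX.closure_eq]
    exact hy
  nonneg := by
    obtain ⟨δ, hδ, hs⟩ := h.nonneg
    exact ⟨δ, hδ, fun s hsX ↦ hs s fun i ↦ hX.subset_ground (hsX i)⟩

lemma encard_isBase (h : PosRep M k pos v) {B : Set α} (hB : M.IsBase B) : B.encard = k := by
  have hli := (h.indep_iff B hB.subset_ground).1 hB.indep
  have hspan : ⊤ ≤ Submodule.span ℝ (range fun x : B ↦ v x) := by
    rw [← image_eq_range, ← h.span_eq, Submodule.span_le]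
    rintro _ ⟨y, hy, rfl⟩
    rw [SetLike.mem_coe, ← h.mem_closure_iff hB.subset_ground hy, hB.closure_eq]
    exact hy
  let b := Module.Basis.mk hli hspan
  have hfin : Finite B := Module.Finite.finite_basis b
  have h1 := Module.finrank_eq_nat_card_basis b
  rw [Module.finrank_fin_fun, Nat.card_coe_set_eq] at h1
  rw [h1, (toFinite B).cast_ncard_eq]

lemma eRank_eq (h : PosRep M k pos v) : M.eRank = k := by
  obtain ⟨B, hB⟩ := M.exists_isBase
  rw [← hB.encard_eq_eRank, h.encard_isBase hB]

end PosRep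

/-- Contracting a vector: expansion of a determinant along a row. -/
lemma exists_det_vecCons_eq (u : Fin (k + 1) → ℝ) (hu : u ≠ 0) :
    ∃ (π : (Fin (k + 1) → ℝ) →ₗ[ℝ] (Fin k → ℝ)) (κ : ℝ), κ ≠ 0 ∧ Function.Surjective π ∧
      π.ker = Submodule.span ℝ {u} ∧ ∀ w : Fin k → Fin (k + 1) → ℝ,
        (Matrix.of (Matrix.vecCons u w)).det = κ * (Matrix.of fun i ↦ π (w i)).det := by
  obtain ⟨i₀, hi₀⟩ := Function.ne_iff.1 hu
  simp only [Pi.zero_apply] at hi₀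
  -- Gaussian elimination: a multiple of `u` clears coordinate `i₀`, which is then dropped.
  let π : (Fin (k + 1) → ℝ) →ₗ[ℝ] (Fin k → ℝ) :=
    { toFun := fun x j ↦ x (i₀.succAbove j) - x i₀ / u i₀ * u (i₀.succAbove j)
      map_add' := fun x y ↦ by ext j; simp only [Pi.add_apply]; ring
      map_smul' := fun c x ↦ by
        ext j; simp only [Pi.smul_apply, smul_eq_mul, RingHom.id_apply]; ring }
  have hπ : ∀ x j, π x j = x (i₀.succAbove j) - x i₀ / u i₀ * u (i₀.succAbove j) := fun _ _ ↦ rfl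
  refine ⟨π, (-1) ^ (i₀ : ℕ) * u i₀, mul_ne_zero (by simp) hi₀, fun y ↦ ?_, ?_, fun w ↦ ?_⟩
  · refine ⟨i₀.insertNth 0 y, ?_⟩
    ext j
    simp [hπ]
  · ext x
    rw [LinearMap.mem_ker, Submodule.mem_span_singleton]
    constructor
    · intro hx
      refine ⟨x i₀ / u i₀, ?_⟩
      ext j
      refine i₀.succAboveCases ?_ (fun j ↦ ?_) j
      · simp [hi₀]
      · have := congrFun hx j
        rw [hπ, Pi.zero_apply, sub_eq_zero] at this
        simp [this]
    · rintro ⟨t, rfl⟩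
      ext j
      rw [hπ]
      simp [hi₀]
  · have h1 : (Matrix.of (Matrix.vecCons u w)).det =
        (Matrix.of (Matrix.vecCons u fun i ↦ w i - (w i i₀ / u i₀) • u)).det := by
      refine Matrix.det_eq_of_forall_row_eq_smul_add_const
        (Matrix.vecCons 0 fun i ↦ w i i₀ / u i₀) 0 rfl fun i j ↦ ?_
      refine Fin.cases ?_ (fun i ↦ ?_) i <;> simp
    rw [h1, Matrix.det_succ_column _ i₀, Fin.sum_univ_succ, Finset.sum_eq_zero, add_zero]
    · simp only [Matrix.of_apply, Matrix.cons_val_zero, Fin.val_zero, zero_add]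
      congr 2
    · intro i _
      simp [hi₀]

lemma linearIndepOn_units_smul (w : α → ℝˣ) (v : α → Fin k → ℝ) (I : Set α) :
    LinearIndepOn ℝ (fun x ↦ w x • v x) I ↔ LinearIndepOn ℝ v I :=
  LinearIndependent.units_smul_iff (fun x : I ↦ v x) fun x : I ↦ w x

lemma span_units_smul (w : α → ℝˣ) (v : α → Fin k → ℝ) (X : Set α) :
    Submodule.span ℝ ((fun x ↦ w x • v x) '' X) = Submodule.span ℝ (v '' X) := by
  refine le_antisymm (Submodule.span_le.2 ?_) (Submodule.span_le.2 ?_)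
  · rintro _ ⟨x, hx, rfl⟩
    exact Submodule.smul_mem _ (w x : ℝ) (Submodule.subset_span (mem_image_of_mem v hx))
  · rintro _ ⟨x, hx, rfl⟩
    have h := Submodule.smul_mem _ (((w x)⁻¹ : ℝˣ) : ℝ)
      (Submodule.subset_span (R := ℝ) (mem_image_of_mem (fun x ↦ w x • v x) hx))
    rw [← Units.smul_def, inv_smul_smul] at h
    exact h

lemma det_units_smul (w : α → ℝˣ) (v : α → Fin k → ℝ) (s : Fin k → α) :
    (Matrix.of fun i ↦ w (s i) • v (s i)).det =
      (∏ i, (w (s i) : ℝ)) * (Matrix.of fun i ↦ v (s i)).det :=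
  Matrix.det_mul_column (fun i ↦ (w (s i) : ℝ)) (Matrix.of fun i ↦ v (s i))

/-- The vectors are taken modulo `v e`, and those that precede `e` are negated. A minor of the
contraction is, up to a constant, the minor with `e` put in front. -/
lemma PosRep.contract {v : α → Fin (k + 1) → ℝ} (h : PosRep M (k + 1) pos v)
    (he : M.IsNonloop e) : ∃ v', PosRep (M ／ {e}) k pos v' := by
  have heE := he.mem_ground
  have hli : LinearIndepOn ℝ v {e} := (h.indep_iff {e} (by simpa)).1 he.indep
  have hve : v e ≠ 0 := by simpa using hli
  obtain ⟨π, κ, hκ, hsurj, hker, hdet⟩ := exists_det_vecCons_eq (v e) hve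
  -- Putting `e` first multiplies the Vandermonde factor by `∏ (pos (s j) - pos e)`, whose sign is
  -- the product of these signs.
  let w : α → ℝˣ := fun x ↦ if pos x < pos e then -1 else 1
  refine ⟨fun x ↦ w x • π (v x), h.injOn.mono sdiff_subset, fun I hI ↦ ?_, ?_, ?_⟩
  · have hI : I ⊆ M.E \ {e} := hI
    have heI : e ∉ I := fun h ↦ (hI h).2 rfl
    rw [linearIndepOn_units_smul, he.contractElem_indep_iff, and_iff_right heI,
      h.indep_iff _ (insert_subset heE (hI.trans sdiff_subset)), ← singleton_union,
      ← hli.quotient_iff_union (by simpa), image_singleton, ← hker]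
    have h2 := (π.quotKerEquivOfSurjective hsurj).toLinearMap.linearIndependent_iff
      (v := fun x : I ↦ π.ker.mkQ (v x)) (LinearEquiv.ker _)
    exact h2.symm
  · rw [eq_top_iff, span_units_smul]
    have h1 : Submodule.map π (Submodule.span ℝ (v '' M.E)) = ⊤ := by
      rw [h.span_eq, Submodule.map_top, LinearMap.range_eq_top.2 hsurj]
    rw [← h1, Submodule.map_span, Submodule.span_le]
    rintro _ ⟨_, ⟨x, hx, rfl⟩, rfl⟩
    by_cases hxe : x = e
    · have : π (v x) = 0 := by
        rw [← LinearMap.mem_ker, hker, hxe]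
        exact Submodule.mem_span_singleton_self _
      rw [this]
      exact zero_mem _
    · exact Submodule.subset_span ⟨x, ⟨hx, hxe⟩, rfl⟩
  · obtain ⟨δ, hδ, hs⟩ := h.nonneg
    refine ⟨δ * κ, mul_ne_zero hδ hκ, fun s hsE ↦ ?_⟩
    have hsE : ∀ i, s i ∈ M.E \ {e} := hsE
    have h1 := hs (Matrix.vecCons e s) (fun i ↦ by
      refine Fin.cases heE (fun i ↦ ?_) i
      exact (hsE i).1)
    rw [comp_vecCons, comp_vecCons, vdm_vecCons, hdet] at h1
    have h2 := det_units_smul w (fun x ↦ π (v x)) s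
    have h3 : (Matrix.of ((fun x ↦ w x • π (v x)) ∘ s)).det = _ := h2
    rw [h3]
    set A := (Matrix.of fun i ↦ π (v (s i))).det
    have h4 : ∃ ρ : ℝ, 0 < ρ ∧ (∏ j, (((pos ∘ s) j : ℝ) - pos e)) = ρ * ∏ i, (w (s i) : ℝ) := by
      refine ⟨∏ j, |((pos ∘ s) j : ℝ) - pos e|, Finset.prod_pos fun j _ ↦ abs_pos.2 ?_, ?_⟩
      · have : pos (s j) ≠ pos e := fun h5 ↦ (hsE j).2 (h.injOn (hsE j).1 heE h5)
        rw [sub_ne_zero]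
        exact_mod_cast this
      · rw [← Finset.prod_mul_distrib]
        refine Finset.prod_congr rfl fun j _ ↦ ?_
        by_cases hj : pos (s j) < pos e
        · have : ((pos (s j) : ℤ) : ℝ) < pos e := by exact_mod_cast hj
          simp [w, hj, abs_of_neg (sub_neg.2 this)]
        · have : (pos e : ℝ) ≤ (pos (s j) : ℤ) := by exact_mod_cast not_lt.1 hj
          simp [w, hj, abs_of_nonneg (sub_nonneg.2 this)]
    obtain ⟨ρ, hρ, h5⟩ := h4
    rw [h5] at h1
    refine nonneg_of_mul_nonneg_right (a := ρ) ?_ hρ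
    calc 0 ≤ _ := h1
      _ = _ := by
        change _ = ρ * (δ * κ * (vdm (pos ∘ s) * ((∏ i, (w (s i) : ℝ)) * A)))
        change δ * ((ρ * ∏ i, (w (s i) : ℝ)) * vdm (pos ∘ s) * (κ * A)) = _
        ring

/-! ### Long lines do not cross -/

/-- The pairs `{p, q}` and `{u, w}` separate each other in the cyclic order. -/
def Crosses (pos : α → ℤ) (p q u w : α) : Prop :=
  (pos u - pos p) * (pos u - pos q) * ((pos w - pos p) * (pos w - pos q)) < 0

lemma linearIndependent_vecCons_vecCons {B C : Set α} {m : ℕ} {s : Fin m → α} {p q : α}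
    {v : α → Fin k → ℝ} (hB : LinearIndepOn ℝ v B) (hs : Function.Injective s) (hsC : range s = C)
    (hp : p ∉ insert q C) (hq : q ∉ C) (hpqB : insert p (insert q C) ⊆ B) :
    LinearIndependent ℝ (v ∘ Matrix.vecCons p (Matrix.vecCons q s)) := by
  subst hsC
  have hinj : Function.Injective (Matrix.vecCons p (Matrix.vecCons q s)) := by
    refine Fin.cons_injective_iff.2 ⟨?_, Fin.cons_injective_iff.2 ⟨hq, hs⟩⟩
    have := Fin.range_cons q s
    change p ∉ range (Fin.cons q s : Fin (m + 1) → α)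
    rwa [this]
  have hmem : ∀ i, Matrix.vecCons p (Matrix.vecCons q s) i ∈ B := by
    refine fun i ↦ hpqB (Fin.cases (Or.inl rfl) (fun i ↦ Or.inr ?_) i)
    exact Fin.cases (Or.inl rfl) (fun i ↦ Or.inr (mem_range_self i)) i
  exact hB.comp (fun i ↦ ⟨_, hmem i⟩) fun i j hij ↦ hinj (Subtype.ext_iff.1 hij)

lemma det_ne_zero_of_linearIndependent {w : Fin k → Fin k → ℝ} (hw : LinearIndependent ℝ w) :
    (Matrix.of w).det ≠ 0 := by
  have : IsUnit (Matrix.of w) := Matrix.linearIndependent_rows_iff_isUnit.1 hw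
  exact ((Matrix.isUnit_iff_isUnit_det _).1 this).ne_zero

lemma det_vecCons_eq_smul {m : ℕ} {x y : Fin (m + 1) → ℝ} {w : Fin m → Fin (m + 1) → ℝ}
    {lam : ℝ} (h : x - lam • y ∈ Submodule.span ℝ (range w)) :
    (Matrix.of (Matrix.vecCons x w)).det = lam * (Matrix.of (Matrix.vecCons y w)).det := by
  have key : ∀ z ∈ Submodule.span ℝ (range w),
      Matrix.detRowAlternating (Matrix.vecCons z w) = 0 := by
    intro z hz
    induction hz using Submodule.span_induction with
    | mem z hz =>
      obtain ⟨i, rfl⟩ := hz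
      exact Matrix.detRowAlternating.map_eq_zero_of_eq _
        (show Matrix.vecCons (w i) w 0 = Matrix.vecCons (w i) w i.succ from rfl)
        (Fin.succ_ne_zero i).symm
    | zero => exact Matrix.detRowAlternating.map_coord_zero 0 rfl
    | add z z' _ _ h h' => rw [AlternatingMap.map_vecCons_add, h, h', add_zero]
    | smul r z _ h => rw [AlternatingMap.map_vecCons_smul, h, smul_zero]
  have h2 := key _ h
  rw [sub_eq_add_neg, AlternatingMap.map_vecCons_add, ← neg_smul,
    AlternatingMap.map_vecCons_smul] at h2
  change Matrix.detRowAlternating (Matrix.vecCons x w) =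
    lam * Matrix.detRowAlternating (Matrix.vecCons y w)
  simp only [smul_eq_mul] at h2
  linarith

/-- In a rank-two contraction, a parallel class is not separated by two elements outside it. -/
lemma PosRep.false_of_crosses (h : PosRep M k pos v) {C : Set α}
    (hB : M.IsBase (insert a (insert b C))) (haC : a ∉ insert b C) (hbC : b ∉ C)
    (hc : c ∈ M.closure (insert a C)) (hcC : c ∉ M.closure C)
    (hd : d ∈ M.E) (hdC : d ∉ M.closure (insert a C)) (hx : Crosses pos a c b d) : False := by
  have hE := hB.subset_ground
  have haE : a ∈ M.E := hE (by simp)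
  have hbE : b ∈ M.E := hE (by simp)
  have hCE : C ⊆ M.E := fun x hx ↦ hE (by simp [hx])
  have hcE : c ∈ M.E := mem_ground_of_mem_closure hc
  have hcard := h.encard_isBase hB
  have hfin : (insert a (insert b C)).Finite := finite_of_encard_eq_coe hcard
  have hCfin : C.Finite := hfin.subset fun x hx ↦ by simp [hx]
  have hk : k = C.ncard + 2 := by
    rw [encard_insert_of_notMem haC, encard_insert_of_notMem hbC, ← hCfin.cast_ncard_eq] at hcard
    have : ((C.ncard + 1 + 1 : ℕ) : ℕ∞) = k := by exact_mod_cast hcard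
    exact_mod_cast this.symm
  obtain ⟨m, s, hs, hsC, hk⟩ : ∃ (m : ℕ) (s : Fin m → α), Function.Injective s ∧ range s = C ∧
      k = m + 2 := by
    have := hCfin.to_subtype
    let f := (Finite.equivFinOfCardEq (Nat.card_coe_set_eq C)).symm
    refine ⟨C.ncard, fun i ↦ f i, fun i j hij ↦ f.injective (Subtype.ext hij), ?_, hk⟩
    have := f.surjective.range_comp (fun x : C ↦ (x : α))
    rw [Subtype.range_coe] at this
    exact this
  subst hk
  have hmemE : ∀ {p q : α}, p ∈ M.E → q ∈ M.E →
      ∀ i, Matrix.vecCons p (Matrix.vecCons q s) i ∈ M.E := by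
    intro p q hp hq
    refine Fin.cases hp (Fin.cases hq fun i ↦ hCE ?_)
    rw [← hsC]
    exact mem_range_self i
  obtain ⟨δ, hδ, hpos⟩ := h.nonneg
  let T : α → ℝ := fun p ↦ ∏ j, ((pos (s j) : ℝ) - pos p)
  let D : α → α → ℝ := fun p q ↦ (Matrix.of (v ∘ Matrix.vecCons p (Matrix.vecCons q s))).det
  let V : ℝ := vdm (pos ∘ s)
  have hF : ∀ p ∈ M.E, ∀ q ∈ M.E,
      0 ≤ δ * ((((pos q : ℝ) - pos p) * T p) * (T q * V) * D p q) := by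
    intro p hp q hq
    have h1 := hpos (Matrix.vecCons p (Matrix.vecCons q s)) (hmemE hp hq)
    have h2 : vdm (pos ∘ Matrix.vecCons p (Matrix.vecCons q s)) =
        (((pos q : ℝ) - pos p) * T p) * (T q * V) := by
      rw [comp_vecCons, vdm_vecCons, comp_vecCons, vdm_vecCons, Fin.prod_univ_succ]
      rfl
    rwa [h2] at h1
  have hV : V ≠ 0 := vdm_ne_zero fun i j hij ↦
    hs (h.injOn (hCE (hsC ▸ mem_range_self i)) (hCE (hsC ▸ mem_range_self j)) hij)
  have hT : ∀ p ∈ M.E, p ∉ C → T p ≠ 0 := by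
    intro p hp hpC
    refine Finset.prod_ne_zero_iff.2 fun j _ ↦ sub_ne_zero.2 fun hj ↦ hpC ?_
    have hsj : s j ∈ C := hsC ▸ mem_range_self j
    have := h.injOn (hCE hsj) hp (Int.cast_injective hj)
    exact this ▸ hsj
  have hD : ∀ p q, p ∉ insert q C → q ∉ C → M.Indep (insert p (insert q C)) → D p q ≠ 0 := by
    intro p q hp hq hI
    refine det_ne_zero_of_linearIndependent ?_
    exact linearIndependent_vecCons_vecCons ((h.indep_iff _ hI.subset_ground).1 hI) hs hsC hp hq
      subset_rfl
  have hCi : M.Indep (insert a C) := hB.indep.subset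
    (insert_subset_insert (subset_insert _ _))
  have hdaC : d ∉ insert a C := fun h ↦ hdC (M.mem_closure_of_mem h)
  have hDab : D a b ≠ 0 := hD a b haC hbC hB.indep
  have hdC' : d ∉ C := fun h ↦ hdaC (Or.inr h)
  have haC' : a ∉ C := fun h ↦ haC (Or.inr h)
  have hcC' : c ∉ C := fun h ↦ hcC (M.mem_closure_of_mem h)
  have hDad : D a d ≠ 0 := by
    refine hD a d ?_ hdC' ?_
    · rintro (rfl | h)
      · exact hdaC (Or.inl rfl)
      · exact haC' h
    · rw [insert_comm, hCi.insert_indep_iff_of_notMem hdaC]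
      exact ⟨hd, hdC⟩
  -- the vector of `c` is a multiple of that of `a` modulo `C`
  have hvc : v c ∈ Submodule.span ℝ (v '' insert a C) :=
    (mem_closure_iff_mem_span_of_indep h.indep_iff hCi hcE).1 hc
  rw [image_insert_eq, Submodule.mem_span_insert] at hvc
  obtain ⟨lam, w, hw, hcw⟩ := hvc
  have hlam : lam ≠ 0 := by
    rintro rfl
    refine hcC ((mem_closure_iff_mem_span_of_indep h.indep_iff (hCi.subset (subset_insert _ _)) hcE).2 ?_)
    rw [hcw, zero_smul, zero_add]
    exact hw
  have hDc : ∀ q, D c q = lam * D a q := by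
    intro q
    have h1 := det_vecCons_eq_smul (x := v c) (y := v a) (lam := lam)
      (w := v ∘ Matrix.vecCons q s) (by
        rw [hcw, add_sub_cancel_left]
        refine Submodule.span_mono ?_ hw
        rw [← hsC]
        rintro _ ⟨_, ⟨i, rfl⟩, rfl⟩
        exact ⟨i.succ, rfl⟩)
    simp only [D]
    rw [comp_vecCons, h1, ← comp_vecCons]
  have f1 := hF a haE b hbE
  have f2 := hF c hcE b hbE
  have f3 := hF a haE d hd
  have f4 := hF c hcE d hd
  rw [hDc] at f2 f4
  have hX : ((pos b : ℝ) - pos a) * ((pos b : ℝ) - pos c) *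
      (((pos d : ℝ) - pos a) * ((pos d : ℝ) - pos c)) < 0 := by
    unfold Crosses at hx
    exact_mod_cast hx
  -- In the product of the four inequalities everything is squared, because `D c q = lam * D a q`,
  -- except the product of the position differences, which is negative by crossing.
  have g := mul_nonneg (mul_nonneg f1 f2) (mul_nonneg f3 f4)
  have hsq : 0 < (δ ^ 2 * V ^ 2 * (T a * T c * lam) * T b * T d * D a b * D a d) ^ 2 := by
    have := hT a haE haC'
    have := hT b hbE hbC
    have := hT c hcE hcC'
    have := hT d hd hdC'
    positivity
  have := mul_neg_of_pos_of_neg hsq hX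
  nlinarith [this, g]

lemma Crosses.symm (h : Crosses pos a c b d) : Crosses pos b d a c := by
  unfold Crosses at *
  nlinarith

lemma Crosses.ne (h : Crosses pos a c b d) :
    a ≠ c ∧ b ≠ d ∧ a ≠ b ∧ a ≠ d ∧ c ≠ b ∧ c ≠ d := by
  unfold Crosses at h
  refine ⟨?_, ?_, ?_, ?_, ?_, ?_⟩ <;> rintro rfl
  · rw [mul_mul_mul_comm] at h
    exact h.not_ge (mul_self_nonneg _)
  · exact h.not_ge (mul_self_nonneg _)
  all_goals simp at h

/-- A line with a third element `x` is not separated by `b`, `d` if these can be exchanged over a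
subset of a basis. -/
lemma PosRep.false_of_crosses_of_indep (h : PosRep M k pos v) (hM : IsSimple M) {I : Set α}
    (hI : M.Indep I) (haI : a ∈ I) (hbI : b ∈ I) (hxI : x ∈ I) (hc : c ∈ M.closure {x, a})
    (hcx : c ≠ x) (hxa : x ≠ a) (hxb : x ≠ b) (hd : d ∈ M.E)
    (hdb : b ∈ M.closure (insert d (I \ {b}))) (hX : Crosses pos a c b d) : False := by
  obtain ⟨B, hB, hIB⟩ := hI.exists_isBase_superset
  have hab := hX.ne.2.2.1
  have haB := hIB haI
  have hbB := hIB hbI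
  have hxB := hIB hxI
  have e1 : insert a (B \ {a, b}) = B \ {b} := by grind
  have e2 : insert b (B \ {a, b}) = B \ {a} := by grind
  have e3 : insert a (insert b (B \ {a, b})) = B := by grind
  have hxC : x ∈ B \ {a, b} := ⟨hxB, by simp [hxa, hxb]⟩
  -- Since `x` is contracted with the rest of the basis, `c` on the line through `x` and `a` becomes
  -- parallel to `a`, while `d` stays outside because it can replace `b`.
  refine h.false_of_crosses (C := B \ {a, b}) (by rwa [e3]) (by simp [e2]) (by simp) (c := c) ?_ ?_
    hd ?_ hX
  · exact M.closure_subset_closure (insert_subset (Or.inr hxC) (by simp)) hc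
  · intro hcC
    refine hB.indep.notMem_closure_sdiff_of_mem haB ?_
    have hxE := hI.subset_ground hxI
    have h1 : a ∈ M.closure {x, c} := by
      rw [hM.closure_pair_congr hxE hc hcx]
      exact M.mem_closure_of_mem' (by simp) (hI.subset_ground haI)
    rw [← e2]
    refine M.closure_subset_closure (subset_insert _ _)
      (M.closure_subset_closure_of_subset_closure ?_ h1)
    exact insert_subset (M.mem_closure_of_mem' hxC hxE) (singleton_subset_iff.2 hcC)
  · rw [e1]
    intro hdC
    refine hB.indep.notMem_closure_sdiff_of_mem hbB ?_
    refine M.closure_subset_closure_of_subset_closure ?_ hdb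
    exact insert_subset hdC fun z hz ↦
      M.mem_closure_of_mem' ⟨hIB hz.1, hz.2⟩ (hI.subset_ground hz.1)

/-- Within a plane, the elements outside a long line are not separated by that line. -/
lemma PosRep.false_of_crosses_plane (h : PosRep M k pos v) (hM : IsSimple M) (hL : IsLongLine M L)
    (ha : a ∈ L) (hc : c ∈ L) (hbL : b ∉ L) (hdL : d ∉ L) (hbE : b ∈ M.E)
    (hd : d ∈ M.closure (insert b L)) (hX : Crosses pos a c b d) : False := by
  obtain ⟨x, hxL, hxa, hxc⟩ := hL.2 a c
  have hLx := hL.1.eq_closure hM hxL ha hxa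
  have hLE := hL.1.subset_ground
  have hI : M.Indep {b, x, a} := by
    rw [(hM x (hLE hxL) a (hLE ha)).insert_indep_iff]
    exact Or.inl ⟨hbE, hLx ▸ hbL⟩
  have hxb : x ≠ b := fun h ↦ hbL (h ▸ hxL)
  have hab : a ≠ b := fun h ↦ hbL (h ▸ ha)
  refine h.false_of_crosses_of_indep hM hI (by simp) (by simp) (by simp) (hLx ▸ hc) hxc.symm hxa
    hxb (mem_ground_of_mem_closure hd) ?_ hX
  have e1 : ({b, x, a} : Set α) \ {b} = {x, a} := by grind
  rw [e1]
  rw [hLx, closure_insert_closure_eq_closure_insert] at hd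
  exact (closure_exchange ⟨hd, hLx ▸ hdL⟩).1

/-- Long lines are non-crossing. -/
lemma PosRep.eq_of_crosses (h : PosRep M k pos v) (hM : IsSimple M) (hL : IsLongLine M L)
    (hL' : IsLongLine M L') (ha : a ∈ L) (hc : c ∈ L) (hb : b ∈ L') (hd : d ∈ L')
    (hX : Crosses pos a c b d) : L = L' := by
  have key : ∀ {L L' : Set α} {a b c d : α}, IsLongLine M L → IsLongLine M L' → a ∈ L → c ∈ L →
      b ∈ L' → d ∈ L' → Crosses pos a c b d → b ∈ L ∨ d ∈ L := by
    intro L L' a b c d hL hL' ha hc hb hd hX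
    by_contra! hcon
    obtain ⟨hbL, hdL⟩ := hcon
    have hLE := hL.1.subset_ground
    have hLE' := hL'.1.subset_ground
    have hdp : d ∉ M.closure (insert b L) := fun hdp ↦
      h.false_of_crosses_plane hM hL ha hc hbL hdL (hLE' hb) hdp hX
    obtain ⟨x, hxL, hxa, hxc⟩ := hL.2 a c
    obtain ⟨y, hyL, hyb, hyd⟩ := hL'.2 b d
    have hLx := hL.1.eq_closure hM hxL ha hxa
    have hI : M.Indep {b, x, a} := by
      rw [(hM x (hLE hxL) a (hLE ha)).insert_indep_iff]
      exact Or.inl ⟨hLE' hb, hLx ▸ hbL⟩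
    have hsub : M.closure {b, x, a} ⊆ M.closure (insert b L) := M.closure_subset_closure
      (insert_subset_insert (insert_subset hxL (by simpa)))
    -- The third element `y` of `L'` completes an independent set over which `b` and `d` are
    -- exchangeable, since `L'` is spanned by `d` and `y`.
    have hy : y ∉ M.closure {b, x, a} := by
      intro hy
      rw [hL'.1.eq_closure hM hb hyL hyb.symm] at hd
      refine hdp (M.closure_subset_closure_of_subset_closure ?_ hd)
      exact insert_subset (M.mem_closure_of_mem' (by simp) (hLE' hb))
        (singleton_subset_iff.2 (hsub hy))
    have hI' : M.Indep {y, b, x, a} := by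
      rw [hI.insert_indep_iff]
      exact Or.inl ⟨hLE' hyL, hy⟩
    have hxb : x ≠ b := fun h ↦ hbL (h ▸ hxL)
    refine h.false_of_crosses_of_indep hM hI' (by simp) (by simp) (by simp) (hLx ▸ hc) hxc.symm
      hxa hxb (hLE' hd) ?_ hX
    rw [hL'.1.eq_closure hM hd hyL hyd.symm] at hb
    refine M.closure_subset_closure ?_ hb
    grind
  obtain ⟨hac, hbd, hab, had, hcb, hcd⟩ := hX.ne
  rcases key hL hL' ha hc hb hd hX with h1 | h1 <;>
  rcases key hL' hL hb hd ha hc hX.symm with h2 | h2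
  · exact hL.1.eq_of_mem hM hL'.1 ha h1 h2 hb hab
  · exact hL.1.eq_of_mem hM hL'.1 hc h1 h2 hb hcb
  · exact hL.1.eq_of_mem hM hL'.1 ha h1 h2 hd had
  · exact hL.1.eq_of_mem hM hL'.1 hc h1 h2 hd hcd

/-! ### Elements on at most one long line -/

lemma IsLine.subset_closure_insert (hM : IsSimple M) (hL : IsLine M L) {F : Set α} (hLF : L ⊆ F)
    (hFE : F ⊆ M.E) (hF : M.eRk F ≤ 3) (hx : x ∈ F) (hxL : x ∉ L) :
    F ⊆ M.closure (insert x L) := by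
  have h1 : M.eRk (insert x L) = 3 := by
    rw [eRk_insert_eq_add_one ⟨hFE hx, by rwa [hL.isFlat.closure]⟩, hL.eRk hM]
    norm_num
  have hfin : M.IsRkFinite (insert x L) := by
    rw [← eRk_lt_top_iff, h1]
    decide
  rw [hfin.closure_eq_closure_of_subset_of_eRk_ge_eRk (insert_subset hx hLF) (by rwa [h1])]
  exact M.subset_closure F hFE

/-- Among three points of a circle, one is separated from `u` by the other two: the product of the
three expressions is minus a nonzero square. -/
lemma exists_neg_of_ne {p q r u : ℤ} (hpq : p ≠ q) (hpr : p ≠ r) (hqr : q ≠ r)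
    (hup : u ≠ p) (huq : u ≠ q) (hur : u ≠ r) :
    (r - p) * (r - q) * ((u - p) * (u - q)) < 0 ∨
    (q - p) * (q - r) * ((u - p) * (u - r)) < 0 ∨
    (p - q) * (p - r) * ((u - q) * (u - r)) < 0 := by
  by_contra! hcon
  obtain ⟨h1, h2, h3⟩ := hcon
  have h4 := mul_nonneg (mul_nonneg h1 h2) h3
  have h5 : 0 < ((p - q) * (p - r) * (q - r) * ((u - p) * (u - q) * (u - r))) ^ 2 := by
    have := sub_ne_zero.2 hpq
    have := sub_ne_zero.2 hpr
    have := sub_ne_zero.2 hqr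
    have := sub_ne_zero.2 hup
    have := sub_ne_zero.2 huq
    have := sub_ne_zero.2 hur
    positivity
  linarith

/-- A long line in a plane contains an element that is on no other long line of the plane. -/
lemma PosRep.exists_unique_long_plane (h : PosRep M k pos v) (hM : IsSimple M)
    (hJ : IsLongLine M J) {F : Set α} (hJF : J ⊆ F) (hFE : F ⊆ M.E) (hF : M.eRk F ≤ 3) :
    ∃ y ∈ J, ∀ J', IsLongLine M J' → J' ⊆ F → y ∈ J' → J' = J := by
  by_cases hFJ : F ⊆ J
  · obtain ⟨y, hy, -⟩ := hJ.2 hJ.1.choose hJ.1.choose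
    refine ⟨y, hy, fun J' hJ' hJ'F hyJ' ↦ ?_⟩
    obtain ⟨z, hz, hzy, -⟩ := hJ'.2 y y
    exact hJ'.1.eq_of_mem hM hJ.1 hyJ' hz hy (hFJ (hJ'F hz)) hzy.symm
  obtain ⟨u, huF, huJ⟩ := not_subset.1 hFJ
  obtain ⟨p, q, y, hp, hq, hy, hX⟩ : ∃ p q y, p ∈ J ∧ q ∈ J ∧ y ∈ J ∧ Crosses pos p q y u := by
    obtain ⟨p, hp, -⟩ := hJ.2 hJ.1.choose hJ.1.choose
    obtain ⟨q, hq, hqp, -⟩ := hJ.2 p p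
    obtain ⟨r, hr, hrp, hrq⟩ := hJ.2 p q
    have hne : ∀ {s t : α}, s ∈ F → t ∈ F → s ≠ t → pos s ≠ pos t :=
      fun hs ht hst hpos ↦ hst (h.injOn (hFE hs) (hFE ht) hpos)
    have hneu : ∀ {s : α}, s ∈ J → pos u ≠ pos s :=
      fun hs ↦ hne huF (hJF hs) (fun h ↦ huJ (h ▸ hs))
    rcases exists_neg_of_ne (hne (hJF hp) (hJF hq) hqp.symm) (hne (hJF hp) (hJF hr) hrp.symm)
      (hne (hJF hq) (hJF hr) hrq.symm) (hneu hp) (hneu hq) (hneu hr) with h1 | h1 | h1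
    · exact ⟨p, q, r, hp, hq, hr, h1⟩
    · exact ⟨p, r, q, hp, hr, hq, h1⟩
    · exact ⟨q, r, p, hq, hr, hp, h1⟩
  refine ⟨y, hy, fun J' hJ' hJ'F hyJ' ↦ ?_⟩
  by_contra hne
  obtain ⟨w, hw, hwy, -⟩ := hJ'.2 y y
  have hwJ : w ∉ J := fun hwJ ↦ hne (hJ'.1.eq_of_mem hM hJ.1 hyJ' hw hy hwJ hwy.symm)
  -- If `p`, `q` separate `w` from `y`, then `J` and `J'` cross. Otherwise `w` is on the side of
  -- `y`, so `p`, `q` separate it from `u`, which is impossible for two elements of the plane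
  -- outside `J`.
  by_cases hXw : Crosses pos p q w y
  · exact hne (h.eq_of_crosses hM hJ hJ' hp hq hw hyJ' hXw).symm
  · refine h.false_of_crosses_plane hM hJ hp hq hwJ huJ (hFE (hJ'F hw))
      (hJ.1.subset_closure_insert hM hJF hFE hF (hJ'F hw) hwJ huF) ?_
    have h1 : ∀ {s : α}, s ∈ J → pos w - pos s ≠ 0 := fun hs h0 ↦
      hwJ (h.injOn (hFE (hJ'F hw)) (hFE (hJF hs)) (sub_eq_zero.1 h0) ▸ hs)
    have h2 := mul_ne_zero (h1 hp) (h1 hq)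
    unfold Crosses at *
    push Not at hXw
    set A := (pos w - pos p) * (pos w - pos q)
    set B := (pos y - pos p) * (pos y - pos q)
    set D := (pos u - pos p) * (pos u - pos q)
    rcases lt_or_gt_of_ne h2 with h3 | h3
    · have : B ≤ 0 := nonpos_of_mul_nonneg_right hXw h3
      have : 0 < D := by
        by_contra! h4
        nlinarith [mul_nonneg_of_nonpos_of_nonpos this h4]
      exact mul_neg_of_neg_of_pos h3 this
    · have : 0 ≤ B := nonneg_of_mul_nonneg_right hXw h3
      have : D < 0 := by
        by_contra! h4
        nlinarith [mul_nonneg this h4]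
      exact mul_neg_of_pos_of_neg h3 this

/-- Some element is on at most one long line. -/
lemma PosRep.exists_unique_long (h : PosRep M k pos v) (hM : IsSimple M) (hfin : M.E.Finite)
    (hne : M.E.Nontrivial) :
    ∃ e L, IsLine M L ∧ e ∈ L ∧ ∀ J, IsLongLine M J → e ∈ J → J = L := by
  by_cases hlong : ∃ L, IsLongLine M L
  swap
  · push Not at hlong
    obtain ⟨x, hx, y, hy, hxy⟩ := hne
    exact ⟨x, _, isLine_closure_pair hx hy hxy, M.mem_closure_of_mem' (by simp) hx,
      fun J hJ ↦ absurd hJ (hlong J)⟩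
  have hspan : ∀ L, IsLongLine M L → ∃ a ∈ L, ∃ b ∈ L, ∀ x ∈ L, pos a ≤ pos x ∧ pos x ≤ pos b := by
    intro L hL
    have hLfin : L.Finite := hfin.subset hL.1.subset_ground
    have hLne : L.Nonempty := by
      obtain ⟨y, hy, -⟩ := hL.2 hL.1.choose hL.1.choose
      exact ⟨y, hy⟩
    obtain ⟨a, ha, ha'⟩ := L.exists_min_image pos hLfin hLne
    obtain ⟨b, hb, hb'⟩ := L.exists_max_image pos hLfin hLne
    exact ⟨a, ha, b, hb, fun x hx ↦ ⟨ha' x hx, hb' x hx⟩⟩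
  -- The possible spreads, last position minus first, of the long lines. The required element is any
  -- inner element of a line of minimal spread.
  let S : Set ℕ := {n | ∃ L, IsLongLine M L ∧ ∃ a ∈ L, ∃ b ∈ L,
    (∀ x ∈ L, pos a ≤ pos x ∧ pos x ≤ pos b) ∧ (pos b - pos a).toNat = n}
  have hS : S.Nonempty := by
    obtain ⟨L, hL⟩ := hlong
    obtain ⟨a, ha, b, hb, hab⟩ := hspan L hL
    exact ⟨_, L, hL, a, ha, b, hb, hab, rfl⟩
  obtain ⟨L, hL, a, ha, b, hb, hab, hmin⟩ := Nat.sInf_mem hS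
  obtain ⟨y, hy, hya, hyb⟩ := hL.2 a b
  have hLE := hL.1.subset_ground
  have hlt : ∀ {s t : α}, s ∈ M.E → t ∈ M.E → s ≠ t → pos s ≤ pos t → pos s < pos t :=
    fun hs ht hst hpos ↦ lt_of_le_of_ne hpos fun h1 ↦ hst (h.injOn hs ht h1)
  have hya' := hlt (hLE ha) (hLE hy) hya.symm (hab y hy).1
  have hyb' := hlt (hLE hy) (hLE hb) hyb (hab y hy).2
  refine ⟨y, L, hL.1, hy, fun J hJ hyJ ↦ ?_⟩
  by_contra hJL
  have hJE := hJ.1.subset_ground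
  -- Another long line through the inner element cannot cross `L` and avoids its ends, so it lies
  -- strictly between them and has smaller spread.
  have hin : ∀ w ∈ J, pos a < pos w ∧ pos w < pos b := by
    intro w hw
    by_cases hwy : w = y
    · exact hwy ▸ ⟨hya', hyb'⟩
    have hwL : w ∉ L := fun hwL ↦ hJL (hJ.1.eq_of_mem hM hL.1 hyJ hw hy hwL (Ne.symm hwy))
    have hwa : pos w ≠ pos a := fun h1 ↦ hwL (h.injOn (hJE hw) (hLE ha) h1 ▸ ha)
    have hwb : pos w ≠ pos b := fun h1 ↦ hwL (h.injOn (hJE hw) (hLE hb) h1 ▸ hb)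
    by_contra hcon
    refine hJL (h.eq_of_crosses hM hL hJ ha hb hyJ hw ?_).symm
    unfold Crosses
    refine mul_neg_of_neg_of_pos (mul_neg_of_pos_of_neg (by omega) (by omega)) ?_
    by_cases h1 : pos w < pos a
    · exact mul_pos_of_neg_of_neg (by omega) (by omega)
    · exact mul_pos (by omega) (by omega)
  obtain ⟨a', ha', b', hb', hab'⟩ := hspan J hJ
  have h1 : (pos b' - pos a').toNat ∈ S := ⟨J, hJ, a', ha', b', hb', hab', rfl⟩
  have h2 := Nat.sInf_le h1
  have h3 := hin a' ha'
  have h4 := hin b' hb'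
  omega

/-! ### The upper bound -/

/-- A simple positroid of rank `k` without `U_{2,ℓ+2}`-minor. -/
structure Admissible (ℓ k : ℕ) (M : Matroid α) : Prop where
  finite : M.E.Finite
  simple : IsSimple M
  rep : ∃ (pos : α → ℤ) (v : α → Fin k → ℝ), PosRep M k pos v
  noMinor : ¬ HasUniformTwoMinor M (ℓ + 2)

lemma Admissible.eRank_eq (h : Admissible ℓ k M) : M.eRank = k := by
  obtain ⟨pos, v, hv⟩ := h.rep
  exact hv.eRank_eq

lemma Admissible.ncard_line_le (h : Admissible ℓ k M) (hL : IsLine M L) : L.ncard ≤ ℓ + 1 := by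
  have h1 := hL.encard_le h.simple (m := ℓ + 1) h.noMinor
  rw [← (h.finite.subset hL.subset_ground).cast_ncard_eq] at h1
  exact_mod_cast h1

lemma Admissible.nontrivial (h : Admissible ℓ (k + 2) M) : M.E.Nontrivial := by
  rw [← one_lt_encard_iff_nontrivial]
  refine lt_of_lt_of_le ?_ M.eRank_le_encard_ground
  rw [h.eRank_eq]
  norm_cast
  omega

/-- This is the simplification of `M ／ {e}`: parallel pairs there come from long lines through `e`,
so they all lie in `L`, of which only `f` is kept. -/
lemma Admissible.contract (h : Admissible ℓ (k + 1) M) (hL : IsLine M L) (heL : e ∈ L)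
    (huniq : ∀ J, IsLongLine M J → e ∈ J → J = L) (hfL : f ∈ L) (hfe : f ≠ e) :
    Admissible ℓ k ((M ／ {e}) ↾ insert f (M.E \ L)) := by
  have hLE := hL.subset_ground
  have hXE : insert f (M.E \ L) ⊆ M.E \ {e} := by
    refine insert_subset ⟨hLE hfL, hfe⟩ fun x hx ↦ ⟨hx.1, ?_⟩
    rintro rfl
    exact hx.2 heL
  have he : M.IsNonloop e := by
    rw [← indep_singleton]
    exact (h.simple e (hLE heL) e (hLE heL)).subset (by simp)
  refine ⟨h.finite.subset (hXE.trans sdiff_subset), ?_, ?_, ?_⟩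
  · intro g hg g' hg'
    have hg : g ∈ insert f (M.E \ L) := hg
    have hg' : g' ∈ insert f (M.E \ L) := hg'
    have hgE := hXE hg
    have hgE' := hXE hg'
    rw [restrict_indep_iff, he.contractElem_indep_iff]
    refine ⟨⟨?_, ?_⟩, by simp_all [insert_subset_iff]⟩
    · rintro (rfl | rfl)
      · exact hgE.2 rfl
      · exact hgE'.2 rfl
    by_cases hgg : g = g'
    · subst hgg
      simpa using h.simple e (hLE heL) g hgE.1
    rw [(h.simple g hgE.1 g' hgE'.1).insert_indep_iff]
    refine Or.inl ⟨hLE heL, fun hecl ↦ ?_⟩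
    have hJ := isLine_closure_pair hgE.1 hgE'.1 hgg
    have hgJ : g ∈ M.closure {g, g'} := M.mem_closure_of_mem' (by simp) hgE.1
    have hgJ' : g' ∈ M.closure {g, g'} := M.mem_closure_of_mem' (by simp) hgE'.1
    have h1 := huniq _ (isLongLine_of_mem hJ hgJ hgJ' hecl hgg hgE.2 hgE'.2) hecl
    rw [h1] at hgJ hgJ'
    have h2 : ∀ {t}, t ∈ insert f (M.E \ L) → t ∈ L → t = f := fun h3 h4 ↦
      h3.resolve_right fun h5 ↦ h5.2 h4
    exact hgg ((h2 hg hgJ).trans (h2 hg' hgJ').symm)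
  · obtain ⟨pos, v, hv⟩ := h.rep
    obtain ⟨v', hv'⟩ := hv.contract he
    refine ⟨pos, v', hv'.restrict ?_⟩
    rw [contract_spanning_iff (by simpa using hLE heL)]
    refine ⟨?_, (subset_sdiff.1 hXE).2⟩
    have hsub : insert f (M.E \ L) ∪ {e} ⊆ M.E :=
      union_subset (hXE.trans sdiff_subset) (by simpa using hLE heL)
    rw [spanning_iff_ground_subset_closure]
    intro x hx
    by_cases hxL : x ∈ L
    · rw [hL.eq_closure h.simple hfL heL hfe] at hxL
      exact M.closure_subset_closure (by simp [insert_subset_iff]) hxL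
    · exact M.mem_closure_of_mem' (Or.inl (Or.inr ⟨hx, hxL⟩))
  · exact fun hU ↦ h.noMinor (hU.of_isMinor (contract_restrict_isMinor hXE))

lemma ncard_insert_sdiff_add (hfin : M.E.Finite) (hL : IsLine M L) (hfL : f ∈ L) :
    (insert f (M.E \ L)).ncard + L.ncard = M.E.ncard + 1 := by
  rw [ncard_insert_of_notMem (fun h ↦ h.2 hfL) (hfin.subset sdiff_subset),
    ← ncard_sdiff_add_ncard_of_subset hL.subset_ground hfin]
  ring

lemma IsLine.exists_ne (hL : IsLine M L) (e : α) : ∃ f ∈ L, f ≠ e := by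
  obtain ⟨x, hx, y, hy, hxy, rfl⟩ := hL
  by_cases h : x = e
  · exact ⟨y, M.mem_closure_of_mem' (by simp) hy, fun h' ↦ hxy (h.trans h'.symm)⟩
  · exact ⟨x, M.mem_closure_of_mem' (by simp) hx, h⟩

/-- Simplifying the contraction of an element on at most one long line costs `|L| - 1 ≤ ℓ` elements
per unit of rank. -/
theorem Admissible.ncard_le (h : Admissible ℓ (k + 1) M) : M.E.ncard ≤ ℓ * k + 1 := by
  induction k generalizing M with
  | zero =>
    by_contra! hcon
    rw [mul_zero, zero_add, one_lt_ncard_iff h.finite] at hcon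
    obtain ⟨x, y, hx, hy, hxy⟩ := hcon
    have h1 := (h.simple x hx y hy).encard_le_eRank
    rw [encard_pair hxy, h.eRank_eq] at h1
    norm_num at h1
  | succ k ih =>
    obtain ⟨pos, v, hv⟩ := h.rep
    obtain ⟨e, L, hL, heL, huniq⟩ := hv.exists_unique_long h.simple h.finite h.nontrivial
    obtain ⟨f, hfL, hfe⟩ := hL.exists_ne e
    have h1 : (insert f (M.E \ L)).ncard ≤ ℓ * k + 1 := ih (h.contract hL heL huniq hfL hfe)
    have h2 := ncard_insert_sdiff_add h.finite hL hfL
    have h3 := h.ncard_line_le hL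
    rw [mul_add]
    omega

/-! ### Parallel connections of lines: simplicity, rank, size and leaves -/

lemma IsUniformTwo.isSimple (h : IsUniformTwo M n) : IsSimple M := by
  intro e he f hf
  rw [h.2]
  refine ⟨insert_subset he (singleton_subset_iff.2 hf), (encard_insert_le _ _).trans ?_⟩
  rw [encard_singleton]
  norm_num

lemma IsUniformTwo.eRank_le (h : IsUniformTwo M n) : M.eRank ≤ 2 := by
  obtain ⟨B, hB⟩ := M.exists_isBase
  rw [← hB.encard_eq_eRank]
  exact ((h.2 B).1 hB.indep).2

lemma IsSimple.subset_closure_pair (hM : IsSimple M) (hX : X ⊆ M.E) (hr : M.eRk X ≤ 2)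
    (hx : x ∈ X) (hy : y ∈ X) (hxy : x ≠ y) : X ⊆ M.closure {x, y} := by
  have h1 : M.eRk {x, y} = 2 := by
    rw [(hM x (hX hx) y (hX hy)).eRk_eq_encard, encard_pair hxy]
  have hfin : M.IsRkFinite {x, y} := by
    rw [← eRk_lt_top_iff, h1]
    decide
  rw [hfin.closure_eq_closure_of_subset_of_eRk_ge_eRk (insert_subset hx (by simpa)) (by rwa [h1])]
  exact M.subset_closure X hX

lemma IsUniformTwo.ground_subset_closure (h : IsUniformTwo M n) (hx : x ∈ M.E) (hy : y ∈ M.E)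
    (hxy : x ≠ y) : M.E ⊆ M.closure {x, y} :=
  h.isSimple.subset_closure_pair subset_rfl (by rw [eRk_ground]; exact h.eRank_le) hx hy hxy

lemma IsUniformTwo.exists_ne (h : IsUniformTwo M (ℓ + 1)) (hℓ : 1 ≤ ℓ) (e : α) :
    ∃ y ∈ M.E, y ≠ e := by
  by_contra! hcon
  have h1 : M.E.encard ≤ 1 := encard_le_one_iff.2 fun a b ha hb ↦
    (hcon a ha).trans (hcon b hb).symm
  rw [h.1] at h1
  have : ℓ + 1 ≤ 1 := by exact_mod_cast h1
  omega

namespace IsParallelConnection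

lemma mem_left (h : IsParallelConnection P M N e) : e ∈ M.E :=
  (h.inter_ground.symm.subset rfl).1

lemma mem_right (h : IsParallelConnection P M N e) : e ∈ N.E :=
  (h.inter_ground.symm.subset rfl).2

lemma eq_base (h : IsParallelConnection P M N e) (hx : x ∈ M.E) (hx' : x ∈ N.E) : x = e :=
  h.inter_ground.subset ⟨hx, hx'⟩

lemma left_subset (h : IsParallelConnection P M N e) : M.E ⊆ P.E :=
  h.ground_eq ▸ subset_union_left

lemma right_subset (h : IsParallelConnection P M N e) : N.E ⊆ P.E :=
  h.ground_eq ▸ subset_union_right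

lemma isSimple (h : IsParallelConnection P M N e) (hM : IsSimple M) (hN : IsSimple N) :
    IsSimple P := by
  have hM0 : M.IsFlat ∅ := isFlat_iff_closure_eq.2 hM.closure_empty
  have hN0 : N.IsFlat ∅ := isFlat_iff_closure_eq.2 hN.closure_empty
  refine isSimple_of_closure (IsFlat.closure ?_) fun x hx ↦ IsFlat.closure ?_
  · rw [h.isFlat_iff]
    simp [hM0, hN0]
  · have key : ∀ {Q : Matroid α}, IsSimple Q → Q.IsFlat ({x} ∩ Q.E) := by
      intro Q hQ
      by_cases hxQ : x ∈ Q.E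
      · rw [inter_eq_left.2 (singleton_subset_iff.2 hxQ)]
        exact isFlat_iff_closure_eq.2 (hQ.closure_singleton hxQ)
      · rw [singleton_inter_eq_empty.2 hxQ]
        exact isFlat_iff_closure_eq.2 hQ.closure_empty
    rw [h.isFlat_iff]
    exact ⟨by simpa [h.ground_eq] using hx, key hM, key hN⟩

lemma restrict_left_of_isSimple (h : IsParallelConnection P M N e) (hN : IsSimple N) :
    P ↾ M.E = M := h.restrict_left (by simp [hN.closure_empty])

lemma eRk_left (h : IsParallelConnection P M N e) (hN : IsSimple N) (hX : X ⊆ M.E) :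
    P.eRk X = M.eRk X := by
  rw [← restrict_eRk_eq P hX, h.restrict_left_of_isSimple hN]

lemma closure_left (h : IsParallelConnection P M N e) (hN : IsSimple N) (hX : X ⊆ M.E) :
    P.closure X ∩ M.E = M.closure X := by
  conv_rhs => rw [← h.restrict_left_of_isSimple hN]
  rw [restrict_closure_eq _ hX h.left_subset]

lemma isFlat_left (h : IsParallelConnection P M N e) (hN : IsSimple N) : P.IsFlat M.E := by
  rw [h.isFlat_iff, inter_self, h.inter_ground]
  exact ⟨subset_union_left, M.ground_isFlat,
    isFlat_iff_closure_eq.2 (hN.closure_singleton h.mem_right)⟩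

lemma right_subset_closure_pair (h : IsParallelConnection P M N e) (hM : IsSimple M)
    (hN : IsUniformTwo N n) (hx : x ∈ N.E) (hy : y ∈ N.E) (hxy : x ≠ y) :
    N.E ⊆ P.closure {x, y} := by
  have h1 := hN.ground_subset_closure hx hy hxy
  rw [← h.symm.closure_left hM (insert_subset hx (by simpa))] at h1
  exact h1.trans inter_subset_left

end IsParallelConnection

namespace IsParallelConnectionOfLines

lemma isSimple (h : IsParallelConnectionOfLines ℓ r M) : IsSimple M := by
  induction h with
  | line hM => exact hM.isSimple
  | connect _ hN hP ih => exact hP.isSimple ih hN.isSimple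

lemma eRank_eq (h : IsParallelConnectionOfLines ℓ r M) (hℓ : 1 ≤ ℓ) : M.eRank = r := by
  induction h with
  | @line M hM =>
    refine le_antisymm hM.eRank_le ?_
    obtain ⟨x, hx, -⟩ : ∃ x ∈ M.E, x ∈ M.E := by
      by_contra! hcon
      have := hM.1
      rw [eq_empty_of_forall_notMem fun x hx ↦ hcon x hx hx, encard_empty] at this
      have : 0 = ℓ + 1 := by exact_mod_cast this
      omega
    obtain ⟨y, hy, hyx⟩ := hM.exists_ne hℓ x
    have h1 := (hM.isSimple y hy x hx).encard_le_eRank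
    rwa [encard_pair hyx] at h1
  | @connect r P M N e hM hN hP ih =>
    have hMs := hM.isSimple
    obtain ⟨y, hy, hye⟩ := hN.exists_ne hℓ e
    have hyM : y ∉ M.E := fun h ↦ hye (hP.eq_base h hy)
    have h1 : P.eRk M.E = r := by rw [hP.eRk_left hN.isSimple subset_rfl, eRk_ground, ih]
    have h2 : P.eRk (insert y M.E) = r + 1 := by
      rw [eRk_insert_eq_add_one, h1]
      rw [(hP.isFlat_left hN.isSimple).closure]
      exact ⟨hP.right_subset hy, hyM⟩
    have h3 : P.Spanning (insert y M.E) := by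
      have hsub : insert y M.E ⊆ P.E := insert_subset (hP.right_subset hy) hP.left_subset
      rw [spanning_iff_ground_subset_closure]
      conv_lhs => rw [hP.ground_eq]
      refine union_subset ((subset_insert _ _).trans (P.subset_closure _)) ?_
      refine (hP.right_subset_closure_pair hMs hN hy hP.mem_right hye).trans ?_
      refine P.closure_subset_closure (insert_subset (by simp) ?_)
      simp [hP.mem_left]
    rw [← h3.eRk_eq, h2]
    norm_cast

lemma encard_add (h : IsParallelConnectionOfLines ℓ r M) :
    M.E.encard + ℓ = ((ℓ * r + 1 : ℕ) : ℕ∞) := by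
  induction h with
  | line hM =>
    rw [hM.1]
    norm_cast
    ring
  | @connect r P M N e hM hN hP ih =>
    have h1 : P.E = M.E ∪ (N.E \ {e}) := by
      rw [hP.ground_eq, ← hP.inter_ground]
      simp
    have h2 : Disjoint M.E (N.E \ {e}) :=
      disjoint_left.2 fun x hx hx' ↦ hx'.2 (hP.eq_base hx hx'.1)
    have h3 : (N.E \ {e}).encard = ℓ := by
      have := encard_sdiff_singleton_add_one hP.mem_right
      rw [hN.1] at this
      push_cast at this
      exact ENat.add_right_injective_of_ne_top (n := 1) (by decide) (by simpa [add_comm] using this)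
    rw [h1, encard_union_eq h2, h3, ih]
    norm_cast
    ring

lemma finite (h : IsParallelConnectionOfLines ℓ r M) : M.E.Finite := by
  refine finite_of_encard_le_coe (k := ℓ * r + 1) ?_
  rw [← h.encard_add]
  exact le_self_add

lemma ncard_add (h : IsParallelConnectionOfLines ℓ r M) : M.E.ncard + ℓ = ℓ * r + 1 := by
  have h1 := h.encard_add
  rw [← h.finite.cast_ncard_eq] at h1
  exact_mod_cast h1

/-- In a parallel connection of lines, some line can be disconnected by removing all but one of its
elements, and that without removing a given element `f`. -/
lemma exists_leaf (h : IsParallelConnectionOfLines ℓ r M) (hℓ : 1 ≤ ℓ) (hf : f ∈ M.E) :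
    ∃ Y ⊆ M.E, f ∉ Y ∧ Y.encard = ℓ ∧ M.IsFlat (M.E \ Y) ∧ M.eRk Y ≤ 2 ∧
      M.eRk (M.E \ Y) + 1 ≤ r := by
  have hcard : ∀ {N : Matroid α} {e : α}, IsUniformTwo N (ℓ + 1) → e ∈ N.E →
      (N.E \ {e}).encard = ℓ := by
    intro N e hN he
    have := encard_sdiff_singleton_add_one he
    rw [hN.1] at this
    push_cast at this
    exact ENat.add_right_injective_of_ne_top (n := 1) (by decide) (by simpa [add_comm] using this)
  induction h generalizing f with
  | @line M hM =>
    have h1 : M.E \ (M.E \ {f}) = {f} := by simpa using hf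
    refine ⟨M.E \ {f}, sdiff_subset, by simp, hcard hM hf, ?_, ?_, ?_⟩
    · rw [h1]
      exact isFlat_iff_closure_eq.2 (hM.isSimple.closure_singleton hf)
    · exact (M.eRk_le_eRank _).trans hM.eRank_le
    · rw [h1]
      refine (add_le_add_left (M.eRk_singleton_le f) 1).trans ?_
      norm_num
  | @connect r P M N e hM hN hP ih =>
    have hMs := hM.isSimple
    have hNs := hN.isSimple
    by_cases hfM : f ∈ M.E
    · have h1 : P.E \ (N.E \ {e}) = M.E := by
        rw [hP.ground_eq]
        ext x
        have h2 : x ∈ M.E → x ∈ N.E → x = e := hP.eq_base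
        have h3 : e ∈ M.E := hP.mem_left
        simp only [mem_sdiff, mem_union, mem_singleton_iff]
        grind
      refine ⟨N.E \ {e}, sdiff_subset.trans hP.right_subset,
        fun h2 ↦ h2.2 (hP.eq_base hfM h2.1), hcard hN hP.mem_right, ?_, ?_, ?_⟩
      · rw [h1]
        exact hP.isFlat_left hNs
      · rw [hP.symm.eRk_left hMs sdiff_subset]
        exact (N.eRk_le_eRank _).trans hN.eRank_le
      · rw [h1, hP.eRk_left hNs subset_rfl, eRk_ground, hM.eRank_eq hℓ]
        norm_cast
    · have hfN : f ∈ N.E := (hP.ground_eq.subset hf).resolve_left hfM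
      -- When `f` is on the attached line only, the leaf is sought in `M` away from the base point
      -- `e`; such a leaf is unaffected by attaching `N`.
      obtain ⟨Y, hY, heY, hYcard, hflat, hYr, hr⟩ := ih hP.mem_left
      have hYN : ∀ x ∈ Y, x ∉ N.E := fun x hx hxN ↦ heY (hP.eq_base (hY hx) hxN ▸ hx)
      have h1 : P.E \ Y = (M.E \ Y) ∪ N.E := by
        rw [hP.ground_eq]
        ext x
        have := hYN x
        grind
      refine ⟨Y, hY.trans hP.left_subset, fun h ↦ hfM (hY h), hYcard, ?_, ?_, ?_⟩
      · rw [h1, hP.isFlat_iff]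
        refine ⟨union_subset_union_left _ sdiff_subset, ?_, ?_⟩
        · have : (M.E \ Y ∪ N.E) ∩ M.E = M.E \ Y := by
            ext x
            have := hYN x
            grind
          rwa [this]
        · rw [inter_eq_right.2 subset_union_right]
          exact N.ground_isFlat
      · rwa [hP.eRk_left hNs hY]
      · have hfe : f ≠ e := fun h ↦ hfM (h ▸ hP.mem_left)
        have hsub : insert f (M.E \ Y) ⊆ P.E :=
          insert_subset hf (sdiff_subset.trans hP.left_subset)
        -- As `e` is not in `Y`, the elements `f` and `e` span the line `N`, so attaching it raises
        -- the rank of the complement by at most one.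
        have h2 : P.E \ Y ⊆ P.closure (insert f (M.E \ Y)) := by
          rw [h1]
          refine union_subset ((subset_insert _ _).trans (P.subset_closure _)) ?_
          refine (hP.right_subset_closure_pair hMs hN hfN hP.mem_right hfe).trans ?_
          exact P.closure_subset_closure (insert_subset_insert (by simp [hP.mem_left, heY]))
        have h3 := (P.eRk_mono h2).trans_eq (P.eRk_closure_eq _)
        have h4 := h3.trans (P.eRk_insert_le_add_one _ _)
        rw [hP.eRk_left hNs sdiff_subset] at h4
        push_cast
        exact add_le_add_left (h4.trans hr) 1

end IsParallelConnectionOfLines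

/-! ### Extremal positroids -/

lemma eRk_insert_le_eRk_contract_add_one (M : Matroid α) (c : α) (Z : Set α)
    (hZ : Z ⊆ M.E \ {c}) : M.eRk (insert c Z) ≤ (M ／ {c}).eRk Z + 1 := by
  obtain ⟨I, hI⟩ := (M ／ {c}).exists_isBasis Z hZ
  have h1 : Z ⊆ M.closure (insert c I) := by
    have := hI.subset_closure
    rw [contract_closure_eq, union_singleton] at this
    exact this.trans sdiff_subset
  have h2 : insert c Z ∩ M.E ⊆ M.closure (insert c I) := by
    rintro x ⟨rfl | hx, hxE⟩
    · exact M.mem_closure_of_mem' (by simp) hxE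
    · exact h1 hx
  rw [← hI.encard_eq_eRk, ← M.eRk_inter_ground]
  refine (M.eRk_mono h2).trans ?_
  rw [eRk_closure_eq]
  exact (M.eRk_le_encard _).trans (encard_insert_le _ _)

/-- Equality in the inductive count leaves no slack in `|L| ≤ ℓ + 1`. -/
lemma Admissible.ncard_line_eq (h : Admissible ℓ (k + 2) M) (hcard : M.E.ncard = ℓ * (k + 1) + 1)
    (hL : IsLine M L) (heL : e ∈ L) (huniq : ∀ J, IsLongLine M J → e ∈ J → J = L) :
    L.ncard = ℓ + 1 := by
  obtain ⟨f, hfL, hfe⟩ := hL.exists_ne e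
  have h1 : (insert f (M.E \ L)).ncard ≤ ℓ * k + 1 := (h.contract hL heL huniq hfL hfe).ncard_le
  have h2 := ncard_insert_sdiff_add h.finite hL hfL
  have h3 := h.ncard_line_le hL
  rw [mul_add] at hcard
  omega

lemma IsLine.isLongLine_of_ncard (hfin : M.E.Finite) (hL : IsLine M L) (h : 3 ≤ L.ncard) :
    IsLongLine M L := by
  refine hL.isLongLine_of_encard ?_
  rw [← (hfin.subset hL.subset_ground).cast_ncard_eq]
  exact_mod_cast h

/-- If `x` were on no long line, the uniqueness condition would hold vacuously for every line
through `x`, forcing that line to have `ℓ + 1 ≥ 3` elements. -/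
lemma Admissible.exists_long (h : Admissible ℓ (k + 2) M) (hcard : M.E.ncard = ℓ * (k + 1) + 1)
    (hℓ : 2 ≤ ℓ) (hx : x ∈ M.E) : ∃ J, IsLongLine M J ∧ x ∈ J := by
  by_contra! hcon
  obtain ⟨y, hy, hyx⟩ := h.nontrivial.exists_ne x
  have hL := isLine_closure_pair hx hy hyx.symm
  have hxL : x ∈ M.closure {x, y} := M.mem_closure_of_mem' (by simp) hx
  have h1 := h.ncard_line_eq hcard hL hxL fun J hJ hxJ ↦ absurd hxJ (hcon J hJ)
  exact hcon _ (hL.isLongLine_of_ncard h.finite (by omega)) hxL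

/-- A set of `ℓ` elements that is complementary to a hyperplane and almost coplanar is a line up to
one element. -/
lemma Admissible.exists_isLine_insert (h : Admissible ℓ (k + 2) M)
    (hcard : M.E.ncard = ℓ * (k + 1) + 1) (hℓ : 1 ≤ ℓ) (hY : Y ⊆ M.E) (hYcard : Y.ncard = ℓ)
    (hH : M.IsFlat (M.E \ Y)) (hHr : M.eRk (M.E \ Y) ≤ (k + 1 : ℕ)) (hcY : c ∉ Y)
    (hYr : M.eRk (insert c Y) ≤ 3) (hL : IsLine M L) (hcL : c ∈ L)
    (huniq : ∀ J, IsLongLine M J → c ∈ J → J = L) (hLY : Disjoint L Y) :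
    ∃ g ∈ M.E \ Y, IsLine M (insert g Y) := by
  have hM := h.simple
  have hcE := hL.subset_ground hcL
  have hYfin := h.finite.subset hY
  have hYne : Y.Nonempty := nonempty_of_ncard_ne_zero (by omega)
  -- For `ℓ = 1` all lines have two elements, and `g = c` works.
  obtain rfl | hℓ2 : ℓ = 1 ∨ 2 ≤ ℓ := by omega
  · obtain ⟨y, rfl⟩ := ncard_eq_one.1 hYcard
    have hyE : y ∈ M.E := hY rfl
    have hcy : c ≠ y := fun h ↦ hcY h
    refine ⟨c, ⟨hcE, hcY⟩, ?_⟩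
    have hK := isLine_closure_pair hcE hyE hcy
    have hsub : {c, y} ⊆ M.closure {c, y} :=
      M.subset_closure _ (insert_subset hcE (singleton_subset_iff.2 hyE))
    have h1 : {c, y} = M.closure {c, y} := eq_of_subset_of_ncard_le hsub
      (by rw [ncard_pair hcy]; exact h.ncard_line_le hK) (h.finite.subset hK.subset_ground)
    rwa [← h1] at hK
  -- a long line through an element of `Y` has at most one element outside `Y`
  have hJH : ∀ {J g g' y}, IsLongLine M J → y ∈ J → y ∈ Y → g ∈ J → g' ∈ J → g ∉ Y → g' ∉ Y →
      g = g' := by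
    intro J g g' y hJ hyJ hyY hg hg' hgY hgY'
    by_contra hne
    have hJE := hJ.1.subset_ground
    rw [hJ.1.eq_closure hM hg hg' hne] at hyJ
    have h1 := M.closure_subset_closure (insert_subset (show g ∈ M.E \ Y from ⟨hJE hg, hgY⟩)
      (singleton_subset_iff.2 (show g' ∈ M.E \ Y from ⟨hJE hg', hgY'⟩))) hyJ
    rw [hH.closure] at h1
    exact h1.2 hyY
  set F := M.closure (insert c Y) with hF
  have hFE : F ⊆ M.E := M.closure_subset_ground _
  have hFr : M.eRk F ≤ 3 := by rwa [hF, eRk_closure_eq]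
  have hYF : Y ⊆ F := fun y hy ↦ M.mem_closure_of_mem' (Or.inr hy) (hY hy)
  have hcF : c ∈ F := M.mem_closure_of_mem' (by simp) hcE
  have hJF : ∀ {J y}, IsLongLine M J → y ∈ J → y ∈ Y → J ⊆ F := by
    intro J y hJ hyJ hyY
    obtain ⟨z, hz, hzy, -⟩ := hJ.2 y y
    obtain ⟨w, hw, hwy, hwz⟩ := hJ.2 y z
    obtain ⟨t, ht, hty, htY⟩ : ∃ t ∈ J, t ≠ y ∧ t ∈ Y := by
      by_cases hzY : z ∈ Y
      · exact ⟨z, hz, hzy, hzY⟩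
      by_cases hwY : w ∈ Y
      · exact ⟨w, hw, hwy, hwY⟩
      exact absurd (hJH hJ hyJ hyY hw hz hwY hzY) hwz
    rw [hJ.1.eq_closure hM hyJ ht hty.symm]
    exact M.closure_subset_closure (insert_subset (Or.inr hyY) (singleton_subset_iff.2 (Or.inr htY)))
  -- Submodularity: the plane `F` and the complement of `Y` together span, so they meet in rank at
  -- most `3 + (k + 1) - (k + 2)`.
  have hFHr : M.eRk (F ∩ (M.E \ Y)) ≤ 2 := by
    have h1 := M.eRk_inter_add_eRk_union_le F (M.E \ Y)
    have h2 : M.eRk (F ∪ (M.E \ Y)) = (k + 2 : ℕ) := by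
      rw [eRk_eq_eRank, h.eRank_eq]
      intro x hx
      by_cases hxY : x ∈ Y
      · exact Or.inl (hYF hxY)
      · exact Or.inr ⟨hx, hxY⟩
    have h3 := h1.trans (add_le_add hFr hHr)
    rw [h2] at h3
    have h4 : (3 : ℕ∞) + (k + 1 : ℕ) = 2 + (k + 2 : ℕ) := by
      norm_cast
      ring
    rw [h4] at h3
    exact (ENat.add_le_add_iff_right (ENat.natCast_ne_top _)).1 h3
  have hcJ : ∀ {J y}, IsLongLine M J → y ∈ J → y ∈ Y → c ∉ J := by
    intro J y hJ hyJ hyY hcJ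
    exact disjoint_left.1 hLY (huniq J hJ hcJ ▸ hyJ) hyY
  -- Otherwise every element of `Y` is on two long lines. Take two through one `y`; each has an
  -- element `zᵢ` on no other long line of `F`, so `zᵢ ∉ Y`. Then `z₁`, `z₂`, `c` lie on one line by
  -- `hFHr`; it is long and must equal `J₁`, which misses `c`.
  obtain ⟨y, J, hyY, hJ, hyJ, hyuniq⟩ : ∃ y J, y ∈ Y ∧ IsLongLine M J ∧ y ∈ J ∧
      ∀ J', IsLongLine M J' → y ∈ J' → J' = J := by
    by_contra! hcon
    obtain ⟨pos, v, hv⟩ := h.rep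
    obtain ⟨y, hyY⟩ := hYne
    obtain ⟨J₁, hJ₁, hyJ₁⟩ := h.exists_long hcard hℓ2 (hY hyY)
    obtain ⟨J₂, hJ₂, hyJ₂, hne⟩ := hcon y J₁ hyY hJ₁ hyJ₁
    have key : ∀ {J}, IsLongLine M J → y ∈ J → ∃ z ∈ J, z ∉ Y ∧
        ∀ J', IsLongLine M J' → J' ⊆ F → z ∈ J' → J' = J := by
      intro J hJ hyJ
      obtain ⟨z, hz, hzu⟩ := hv.exists_unique_long_plane hM hJ (hJF hJ hyJ hyY) hFE hFr
      refine ⟨z, hz, fun hzY ↦ ?_, hzu⟩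
      obtain ⟨J', hJ', hzJ', hne'⟩ := hcon z J hzY hJ hz
      exact hne' (hzu J' hJ' (hJF hJ' hzJ' hzY) hzJ')
    obtain ⟨z₁, hz₁, hz₁Y, hz₁u⟩ := key hJ₁ hyJ₁
    obtain ⟨z₂, hz₂, hz₂Y, hz₂u⟩ := key hJ₂ hyJ₂
    have hJ₁F := hJF hJ₁ hyJ₁ hyY
    have hJ₂F := hJF hJ₂ hyJ₂ hyY
    have hz₁F := hJ₁F hz₁
    have hz₂F := hJ₂F hz₂
    have hz : z₁ ≠ z₂ := by
      rintro rfl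
      exact hne (hz₁u J₂ hJ₂ hJ₂F hz₂)
    have hcJ₁ := hcJ hJ₁ hyJ₁ hyY
    have hcJ₂ := hcJ hJ₂ hyJ₂ hyY
    have hK := isLine_closure_pair (hFE hz₁F) (hFE hz₂F) hz
    have hcK : c ∈ M.closure {z₁, z₂} := hM.subset_closure_pair (inter_subset_left.trans hFE) hFHr
      ⟨hz₁F, hFE hz₁F, hz₁Y⟩ ⟨hz₂F, hFE hz₂F, hz₂Y⟩ hz ⟨hcF, hcE, hcY⟩
    have hz₁K : z₁ ∈ M.closure {z₁, z₂} := M.mem_closure_of_mem' (by simp) (hFE hz₁F)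
    have hz₂K : z₂ ∈ M.closure {z₁, z₂} := M.mem_closure_of_mem' (by simp) (hFE hz₂F)
    have hKl := isLongLine_of_mem hK hz₁K hz₂K hcK hz (fun h ↦ hcJ₁ (h ▸ hz₁))
      (fun h ↦ hcJ₂ (h ▸ hz₂))
    have hKF : M.closure {z₁, z₂} ⊆ F := M.closure_subset_closure_of_subset_closure
      (insert_subset hz₁F (singleton_subset_iff.2 hz₂F))
    exact hcJ₁ (hz₁u _ hKl hKF hz₁K ▸ hcK)
  have hJcard := h.ncard_line_eq hcard hJ.1 hyJ hyuniq
  have hJE := hJ.1.subset_ground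
  have hJfin := h.finite.subset hJE
  -- `J` has `ℓ + 1` elements, at most one of them outside the `ℓ`-element set `Y`, so `J` is `Y`
  -- and one further element.
  have h1 : (J \ Y).ncard ≤ 1 := (ncard_le_one (hJfin.subset sdiff_subset)).2
    fun g hg g' hg' ↦ hJH hJ hyJ hyY hg.1 hg'.1 hg.2 hg'.2
  have h2 : (J ∩ Y).ncard ≤ ℓ := hYcard ▸ ncard_le_ncard inter_subset_right hYfin
  have h3 := ncard_inter_add_ncard_sdiff_eq_ncard J Y hJfin
  obtain ⟨g, hg⟩ := ncard_eq_one.1 (show (J \ Y).ncard = 1 by omega)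
  have h4 : J ∩ Y = Y := eq_of_subset_of_ncard_le inter_subset_right (by omega) hYfin
  have hgJ : g ∈ J \ Y := hg ▸ mem_singleton g
  refine ⟨g, ⟨hJE hgJ.1, hgJ.2⟩, ?_⟩
  have h5 : insert g Y = J := by
    rw [← inter_union_sdiff J Y, hg, h4, union_singleton]
  rw [h5]
  exact hJ.1

/-- A hyperplane of an admissible matroid is admissible. -/
lemma Admissible.restrict_isFlat (h : Admissible ℓ (k + 1) M) (hH : M.IsFlat H) (hy : y ∈ M.E)
    (hyH : y ∉ H) (hsp : M.E ⊆ M.closure (insert y H)) : Admissible ℓ k (M ↾ H) := by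
  have hHE := hH.subset_ground
  refine ⟨h.finite.subset hHE, h.simple.restrict hHE, ?_,
    fun hU ↦ h.noMinor (hU.of_isMinor (restrict_isMinor hHE))⟩
  have hyn : M.IsNonloop y := by
    rw [← indep_singleton]
    exact (h.simple y hy y hy).subset (by simp)
  -- Contracting `y` outside the flat `H` does not change the matroid on `H`, and it provides a
  -- representation in `k` coordinates.
  have heq : M ↾ H = (M ／ {y}) ↾ H := by
    refine ext_indep rfl fun I hI ↦ ?_
    have hI : I ⊆ H := hI
    rw [restrict_indep_iff, restrict_indep_iff, hyn.contractElem_indep_iff]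
    refine and_congr_left fun _ ↦ ⟨fun hIi ↦ ⟨fun hyI ↦ hyH (hI hyI), ?_⟩,
      fun hIi ↦ hIi.2.subset (subset_insert _ _)⟩
    rw [hIi.insert_indep_iff]
    refine Or.inl ⟨hy, fun hycl ↦ hyH ?_⟩
    rw [← hH.closure]
    exact M.closure_subset_closure hI hycl
  rw [heq]
  obtain ⟨pos, v, hv⟩ := h.rep
  obtain ⟨v', hv'⟩ := hv.contract hyn
  refine ⟨pos, v', hv'.restrict ?_⟩
  rw [contract_spanning_iff (by simpa using hy), union_singleton]
  exact ⟨(spanning_iff_ground_subset_closure (insert_subset hy hHE)).2 hsp, by simpa⟩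

/-- The induction hypothesis is used twice: on the simplified contraction, to find a leaf `Y`, and
on the hyperplane complementary to `Y`. -/
theorem Admissible.isParallelConnectionOfLines (h : Admissible ℓ (k + 2) M)
    (hcard : M.E.ncard = ℓ * (k + 1) + 1) (hℓ : 1 ≤ ℓ) :
    IsParallelConnectionOfLines ℓ (k + 2) M := by
  induction k generalizing M with
  | zero =>
    refine .line ?_
    rw [← M.restrict_ground_eq_self]
    refine isUniformTwo_restrict h.simple subset_rfl ?_ ?_
    · rw [eRk_ground, h.eRank_eq]
      norm_num
    · rw [← h.finite.cast_ncard_eq, hcard]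
      norm_num
  | succ k ih =>
    obtain ⟨pos, v, hv⟩ := h.rep
    obtain ⟨c, L, hL, hcL, huniq⟩ := hv.exists_unique_long h.simple h.finite h.nontrivial
    obtain ⟨f, hfL, hfc⟩ := hL.exists_ne c
    have hLE := hL.subset_ground
    have hcE := hLE hcL
    have hLcard := h.ncard_line_eq hcard hL hcL huniq
    have hXcard := ncard_insert_sdiff_add h.finite hL hfL
    have hN := ih (h.contract hL hcL huniq hfL hfc) (by
      rw [restrict_ground_eq]
      rw [mul_add _ (k + 1)] at hcard
      omega)
    -- Avoiding `f`, the only element of `L` that was kept, makes the leaf disjoint from `L`.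
    obtain ⟨Y, hYX, hfY, hYcard, hYflat, hYr, hHr⟩ := hN.exists_leaf hℓ (mem_insert f _)
    simp only [restrict_ground_eq] at hYX hYflat hHr
    set X := insert f (M.E \ L) with hX
    have hXE : X ⊆ M.E \ {c} := insert_subset ⟨hLE hfL, hfc⟩ fun x hx ↦ ⟨hx.1, fun hxc ↦
      hx.2 ((show x = c from hxc) ▸ hcL)⟩
    have hYE : Y ⊆ M.E := hYX.trans (hXE.trans sdiff_subset)
    have hLY : Disjoint L Y := disjoint_left.2 fun x hxL hxY ↦
      (hYX hxY).elim (fun hxf ↦ hfY (hxf ▸ hxY)) fun hx ↦ hx.2 hxL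
    have hcY : c ∉ Y := disjoint_left.1 hLY hcL
    have hYn : Y.ncard = ℓ := by
      rw [← (h.finite.subset hYE).cast_ncard_eq] at hYcard
      exact_mod_cast hYcard
    have hHsub : M.E \ Y ⊆ M.closure (insert c (X \ Y)) := by
      intro x hx
      by_cases hxL : x ∈ L
      · rw [hL.eq_closure h.simple hcL hfL hfc.symm] at hxL
        refine M.closure_subset_closure (insert_subset_insert ?_) hxL
        exact singleton_subset_iff.2 ⟨Or.inl rfl, hfY⟩
      · exact M.mem_closure_of_mem' (Or.inr ⟨Or.inr ⟨hx.1, hxL⟩, hx.2⟩) hx.1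
    have hH : M.IsFlat (M.E \ Y) := by
      rw [isFlat_iff_closure_eq]
      refine subset_antisymm (fun x hx ↦ ?_) (M.subset_closure _ sdiff_subset)
      have hxE := mem_ground_of_mem_closure hx
      refine ⟨hxE, fun hxY ↦ ?_⟩
      have h1 : x ∈ ((M ／ {c}) ↾ X).closure (X \ Y) := by
        rw [restrict_closure_eq _ sdiff_subset hXE, contract_closure_eq, union_singleton]
        exact ⟨⟨M.closure_subset_closure_of_subset_closure hHsub hx, (hXE (hYX hxY)).2⟩, hYX hxY⟩
      rw [hYflat.closure] at h1
      exact h1.2 hxY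
    rw [restrict_eRk_eq _ hYX] at hYr
    rw [restrict_eRk_eq _ sdiff_subset] at hHr
    have hHr' : M.eRk (M.E \ Y) ≤ (k + 1 + 1 : ℕ) := by
      have h1 := (M.eRk_mono hHsub).trans_eq (M.eRk_closure_eq _)
      exact (h1.trans (eRk_insert_le_eRk_contract_add_one M c _
        (sdiff_subset.trans hXE))).trans hHr
    have hYr' : M.eRk (insert c Y) ≤ 3 := by
      refine (eRk_insert_le_eRk_contract_add_one M c _ (hYX.trans hXE)).trans
        ((add_le_add_left hYr 1).trans ?_)
      norm_num
    obtain ⟨g, hg, hK⟩ := h.exists_isLine_insert hcard hℓ hYE hYn hH hHr' hcY hYr' hL hcL huniq hLY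
    have hKE := hK.subset_ground
    obtain ⟨y, hy⟩ := nonempty_of_ncard_ne_zero (s := Y) (by omega)
    have hKcard : (insert g Y).encard = (ℓ + 1 : ℕ) := by
      rw [encard_insert_of_notMem hg.2, hYcard]
      norm_cast
    have hKpair : ∀ x ∈ insert g Y, ∀ y ∈ insert g Y, x ≠ y → insert g Y ⊆ M.closure {x, y} :=
      fun x hx y hy hxy ↦ (hK.eq_closure h.simple hx hy hxy).subset
    refine .connect (M := M ↾ (M.E \ Y)) (N := M ↾ (insert g Y)) (e := g) (ih ?_ ?_)
      (isUniformTwo_restrict h.simple hKE (hK.eRk h.simple).le hKcard) ?_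
    · refine h.restrict_isFlat hH (hYE hy) (fun h ↦ h.2 hy) fun x hx ↦ ?_
      by_cases hxY : x ∈ Y
      · refine M.closure_subset_closure ?_ (hKpair y (Or.inr hy) g (Or.inl rfl)
          (fun h ↦ hg.2 (h ▸ hy)) (Or.inr hxY))
        exact insert_subset_insert (singleton_subset_iff.2 hg)
      · exact M.mem_closure_of_mem' (Or.inr ⟨hx, hxY⟩) hx
    · rw [restrict_ground_eq, ncard_sdiff hYE (h.finite.subset hYE), hcard, hYn]
      have : ℓ * (k + 1 + 1) = ℓ * (k + 1) + ℓ := by ring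
      omega
    · refine isParallelConnection_restrict ?_ ?_ hH hKpair
      · ext x
        have := @hYE x
        have : g ∈ M.E := hg.1
        grind
      · ext x
        have : g ∈ M.E := hg.1
        have : g ∉ Y := hg.2
        grind

/-! ### Translation between positroid matrices and `PosRep` -/

lemma linearIndepOn_image_iff {β : Type*} {φ : β → α} (hφ : Function.Injective φ)
    (v : α → Fin k → ℝ) (J : Set β) : LinearIndepOn ℝ v (φ '' J) ↔ LinearIndepOn ℝ (v ∘ φ) J :=
  ⟨fun h ↦ h.comp_of_image hφ.injOn, fun h ↦ h.image_of_comp φ v⟩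

lemma IsPositroid.exists_posRep (h : IsPositroid M) : ∃ k pos v, PosRep M k pos v := by
  obtain ⟨k, n, A, φ, hφ, hφE, hind, hrk, hpos⟩ := h
  refine ⟨k, Function.extend φ (fun j ↦ ((j : ℕ) : ℤ)) 0, Function.extend φ A.col 0,
    ?_, ?_, ?_, 1, one_ne_zero, ?_⟩
  · rw [← hφE]
    rintro _ ⟨i, rfl⟩ _ ⟨j, rfl⟩ hij
    rw [hφ.extend_apply, hφ.extend_apply] at hij
    rw [Fin.ext (by exact_mod_cast hij : (i : ℕ) = j)]
  · intro I hI
    rw [← hφE] at hI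
    obtain ⟨J, rfl⟩ := subset_range_iff_exists_image_eq.1 hI
    rw [hind, linearIndepOn_image_iff hφ, Function.extend_comp hφ]
  · rw [← hφE, ← range_comp, Function.extend_comp hφ]
    refine Submodule.eq_top_of_finrank_eq ?_
    rw [← Matrix.rank_eq_finrank_span_cols, hrk, Module.finrank_fin_fun]
  · intro s hs
    rw [← hφE] at hs
    choose t ht using hs
    obtain rfl : φ ∘ t = s := funext ht
    have h1 : Function.extend φ (fun j ↦ ((j : ℕ) : ℤ)) 0 ∘ (φ ∘ t) = fun i ↦ ((t i : ℕ) : ℤ) := by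
      rw [← Function.comp_assoc, Function.extend_comp hφ]
      rfl
    by_cases htinj : Function.Injective t
    swap
    · rw [h1, vdm_eq_zero]
      · simp
      · exact fun h2 ↦ htinj fun i j hij ↦ h2 (by simp [hij])
    have hmono : StrictMono (t ∘ Tuple.sort t) :=
      (Tuple.monotone_sort t).strictMono_of_injective (htinj.comp (Equiv.injective _))
    rw [one_mul, ← vdm_mul_det_comp_perm _ _ (φ ∘ t) (Tuple.sort t)]
    refine mul_nonneg ?_ ?_
    · rw [← Function.comp_assoc, h1]
      refine (vdm_pos fun i j hij ↦ ?_).le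
      have := hmono hij
      simp only [Function.comp_apply]
      exact_mod_cast this
    · have h2 := hpos (OrderEmbedding.ofStrictMono _ hmono)
      rw [← Matrix.det_transpose] at h2
      convert! h2 using 2
      ext i j
      simp only [Function.comp_apply, Matrix.of_apply, hφ.extend_apply]
      rfl

lemma PosRep.isPositroid (h : PosRep M k pos v) (hfin : M.E.Finite) : IsPositroid M := by
  classical
  obtain ⟨δ, hδ, hnn⟩ := h.nonneg
  -- list the ground set in increasing order
  obtain ⟨n, φ, hφE, hmono⟩ : ∃ (n : ℕ) (φ : Fin n → α), range φ = M.E ∧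
      StrictMono (pos ∘ φ) := by
    let S := hfin.toFinset.image pos
    let g := S.orderEmbOfFin rfl
    have hg : ∀ i, ∃ x ∈ M.E, pos x = g i := fun i ↦ by
      obtain ⟨x, hx, hxp⟩ := Finset.mem_image.1 (S.orderEmbOfFin_mem rfl i)
      exact ⟨x, hfin.mem_toFinset.1 hx, hxp⟩
    choose φ hφE hφ using hg
    refine ⟨S.card, φ, subset_antisymm (range_subset_iff.2 hφE) fun x hx ↦ ?_, ?_⟩
    · have hxS : pos x ∈ (S : Set ℤ) := by
        simpa [S] using ⟨x, hx, rfl⟩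
      rw [← S.range_orderEmbOfFin rfl] at hxS
      obtain ⟨i, hi⟩ := hxS
      exact ⟨i, h.injOn (hφE i) hx ((hφ i).trans hi)⟩
    · have : pos ∘ φ = g := funext hφ
      rw [this]
      exact g.strictMono
  have hφ : Function.Injective φ := hmono.injective.of_comp
  -- Scaling the first row by `δ` absorbs the common sign of the minors; for `k = 0` there is no row
  -- to scale, but the empty minor is `1`.
  let ε : Fin k → ℝˣ := fun i ↦ if (i : ℕ) = 0 then Units.mk0 δ hδ else 1
  let T : (Fin k → ℝ) ≃ₗ[ℝ] (Fin k → ℝ) :=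
    LinearEquiv.piCongrRight fun i ↦ LinearEquiv.smulOfUnit (ε i)
  let A : Matrix (Fin k) (Fin n) ℝ := Matrix.of fun i j ↦ (ε i : ℝ) * v (φ j) i
  have hA : A.col = T ∘ v ∘ φ := rfl
  refine ⟨k, n, A, φ, hφ, hφE, fun J ↦ ?_, ?_, fun c ↦ ?_⟩
  · rw [h.indep_iff _ (hφE ▸ image_subset_range φ J), linearIndepOn_image_iff hφ]
    exact (T.toLinearMap.linearIndependent_iff (v := fun x : J ↦ v (φ x)) (LinearEquiv.ker _)).symm
  · rw [Matrix.rank_eq_finrank_span_cols, hA, range_comp, range_comp, hφE]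
    have h1 := Submodule.map_span T.toLinearMap (v '' M.E)
    rw [h.span_eq, Submodule.map_top, LinearEquiv.range] at h1
    have h2 : Submodule.span ℝ (T '' (v '' M.E)) = ⊤ := h1.symm
    rw [h2, finrank_top, Module.finrank_fin_fun]
  · have h1 : (A.submatrix id c).det =
        (∏ i, (ε i : ℝ)) * (Matrix.of (v ∘ (φ ∘ c))).det := by
      rw [← Matrix.det_transpose (Matrix.of (v ∘ (φ ∘ c)))]
      exact Matrix.det_mul_column (fun i ↦ (ε i : ℝ)) (Matrix.of (v ∘ (φ ∘ c))).transpose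
    rw [h1]
    cases k with
    | zero => simp
    | succ k =>
      have h2 : ∏ i, (ε i : ℝ) = δ := by
        rw [Fin.prod_univ_succ, Finset.prod_eq_one]
        · simp [ε]
        · simp [ε]
      rw [h2]
      have h3 := hnn (φ ∘ c) fun i ↦ hφE ▸ mem_range_self (c i)
      have h4 : 0 < vdm (pos ∘ (φ ∘ c)) := vdm_pos (hmono.comp c.strictMono)
      refine nonneg_of_mul_nonneg_right (a := vdm (pos ∘ (φ ∘ c))) ?_ h4
      linarith

/-! ### Minors of parallel connections -/

/-- `S` consists of representatives of distinct points of a line of the contraction `M ／ W`. -/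
structure LineOver (M : Matroid α) (W S : Set α) : Prop where
  subset : S ⊆ M.E
  notMem : ∀ x ∈ S, x ∉ M.closure W
  notMem_insert : ∀ x ∈ S, ∀ y ∈ S, x ≠ y → y ∉ M.closure (insert x W)
  subset_closure : ∀ x ∈ S, ∀ y ∈ S, x ≠ y → S ⊆ M.closure (insert x (insert y W))

lemma HasUniformTwoMinor.exists_lineOver (h : HasUniformTwoMinor M n) :
    ∃ W S : Set α, S.encard = n ∧ LineOver M W S := by
  obtain ⟨N, hNM, hN⟩ := h
  obtain ⟨C, D, hC, hD, hCD, rfl⟩ := hNM.exists_eq_contract_delete_disjoint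
  have hS := hN.isSimple
  have hE : (M ／ C ＼ D).E ⊆ M.E := sdiff_subset.trans sdiff_subset
  have hcl : ∀ Z x, x ∈ (M ／ C ＼ D).E → Z ⊆ (M ／ C ＼ D).E →
      (x ∈ (M ／ C ＼ D).closure Z ↔ x ∈ M.closure (Z ∪ C)) := by
    intro Z x hx hZ
    have hZD : Disjoint Z D := disjoint_left.2 fun z hz hzD ↦ (hZ hz).2 hzD
    rw [delete_closure_eq_of_disjoint _ hZD, contract_closure_eq]
    exact ⟨fun h ↦ h.1.1, fun h ↦ ⟨⟨h, hx.1.2⟩, hx.2⟩⟩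
  refine ⟨C, (M ／ C ＼ D).E, hN.1, hE, fun x hx hxC ↦ ?_, fun x hx y hy hxy hyC ↦ ?_,
    fun x hx y hy hxy z hz ↦ ?_⟩
  · have := (hcl ∅ x hx (empty_subset _)).2 (by simpa using hxC)
    simp [hS.closure_empty] at this
  · have := (hcl {x} y hy (by simpa using hx)).2 (by simpa using hyC)
    rw [hS.closure_singleton hx] at this
    exact hxy this.symm
  · have := hN.ground_subset_closure hx hy hxy hz
    rw [hcl {x, y} z hz (insert_subset hx (singleton_subset_iff.2 hy))] at this
    convert! this using 2
    simp [insert_union]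

lemma LineOver.hasUniformTwoMinor {W S : Set α} (h : LineOver M W S) (hn : S.encard = n)
    (hW : W ⊆ M.E) : HasUniformTwoMinor M n := by
  have hSW : S ⊆ M.E \ W := fun x hx ↦ ⟨h.subset hx, fun hxW ↦
    h.notMem x hx (M.mem_closure_of_mem hxW)⟩
  refine ⟨_, contract_restrict_isMinor hSW, ?_⟩
  have hcl : ∀ Z, Z ⊆ S → ((M ／ W) ↾ S).closure Z = M.closure (Z ∪ W) ∩ S := by
    intro Z hZ
    rw [restrict_closure_eq _ hZ hSW, contract_closure_eq]
    ext x
    have : x ∈ S → x ∉ W := fun hx ↦ (hSW hx).2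
    simp only [mem_inter_iff, mem_sdiff]
    tauto
  have hs : IsSimple ((M ／ W) ↾ S) := by
    refine isSimple_of_closure ?_ fun x hx ↦ ?_
    · rw [hcl _ (empty_subset _), empty_union]
      exact eq_empty_of_forall_notMem fun x hx ↦ h.notMem x hx.2 hx.1
    · have hx : x ∈ S := hx
      rw [hcl _ (singleton_subset_iff.2 hx), singleton_union]
      refine subset_antisymm (fun y hy ↦ ?_) (singleton_subset_iff.2
        ⟨M.mem_closure_of_mem' (by simp) (h.subset hx), hx⟩)
      by_contra hne
      exact h.notMem_insert x hx y hy.2 (Ne.symm hne) hy.1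
  have h1 := isUniformTwo_restrict hs (S := S) subset_rfl ?_ hn
  · rwa [restrict_restrict_eq _ subset_rfl] at h1
  by_cases hS : ∃ x ∈ S, ∃ y ∈ S, x ≠ y
  · obtain ⟨x, hx, y, hy, hxy⟩ := hS
    have h2 : S ⊆ ((M ／ W) ↾ S).closure {x, y} := by
      rw [hcl _ (insert_subset hx (singleton_subset_iff.2 hy))]
      refine subset_inter ?_ subset_rfl
      convert! h.subset_closure x hx y hy hxy using 2
      simp [insert_union]
    refine (Matroid.eRk_mono _ h2).trans ?_
    rw [eRk_closure_eq]
    exact (Matroid.eRk_le_encard _ _).trans (encard_pair hxy).le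
  · push Not at hS
    refine (Matroid.eRk_le_encard _ _).trans ((encard_le_one_iff.2 fun x y hx hy ↦
      hS x hx y hy).trans ?_)
    norm_num

lemma LineOver.closure {W S : Set α} (h : LineOver M W S) : LineOver M (M.closure W) S := by
  refine ⟨h.subset, ?_, ?_, ?_⟩
  · simpa using h.notMem
  · simpa using h.notMem_insert
  · intro x hx y hy hxy
    have := h.subset_closure x hx y hy hxy
    rw [← M.closure_insert_closure_eq_closure_insert x,
      M.closure_insert_closure_eq_closure_insert y, M.closure_insert_closure_eq_closure_insert]
    exact this

/-- Points of the contraction may be represented by other elements of their parallel classes; this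
is how a line is moved to one side of a parallel connection. -/
lemma LineOver.image {W S : Set α} (h : LineOver M W S) {τ : α → α}
    (hτE : ∀ x ∈ S, τ x ∈ M.E)
    (hτ : ∀ x ∈ S, M.closure (insert (τ x) W) = M.closure (insert x W)) :
    LineOver M W (τ '' S) ∧ InjOn τ S := by
  have hmem : ∀ x ∈ S, x ∈ M.closure (insert (τ x) W) := fun x hx ↦
    hτ x hx ▸ M.mem_closure_of_mem' (by simp) (h.subset hx)
  have hmem' : ∀ x ∈ S, τ x ∈ M.closure (insert x W) := fun x hx ↦
    hτ x hx ▸ M.mem_closure_of_mem' (by simp) (hτE x hx)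
  refine ⟨⟨?_, ?_, ?_, ?_⟩, fun x hx y hy hxy ↦ ?_⟩
  · rintro _ ⟨x, hx, rfl⟩
    exact hτE x hx
  · rintro _ ⟨x, hx, rfl⟩ hc
    refine h.notMem x hx ?_
    have := hmem x hx
    rwa [closure_insert_eq_of_mem_closure hc] at this
  · rintro _ ⟨x, hx, rfl⟩ _ ⟨y, hy, rfl⟩ hxy hc
    rw [hτ x hx] at hc
    refine h.notMem_insert x hx y hy (fun hxy' ↦ hxy (hxy' ▸ rfl)) ?_
    have h1 : M.closure (insert (τ y) W) ⊆ M.closure (insert x W) := by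
      rw [← closure_insert_eq_of_mem_closure hc]
      exact M.closure_subset_closure (insert_subset_insert (subset_insert _ _))
    exact h1 (hmem y hy)
  · rintro _ ⟨x, hx, rfl⟩ _ ⟨y, hy, rfl⟩ hxy
    have hxy' : x ≠ y := fun hxy' ↦ hxy (hxy' ▸ rfl)
    have h1 : M.closure (insert x (insert y W)) = M.closure (insert (τ x) (insert (τ y) W)) := by
      rw [← M.closure_insert_closure_eq_closure_insert x, ← hτ y hy,
        M.closure_insert_closure_eq_closure_insert, insert_comm,
        ← M.closure_insert_closure_eq_closure_insert (τ y), ← hτ x hx,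
        M.closure_insert_closure_eq_closure_insert, insert_comm]
    rw [← h1]
    rintro _ ⟨z, hz, rfl⟩
    have hz' := h.subset_closure x hx y hy hxy' hz
    have h2 := hmem' z hz
    have h3 : M.closure (insert z W) ⊆ M.closure (insert x (insert y W)) := by
      rw [← closure_insert_eq_of_mem_closure hz']
      exact M.closure_subset_closure (insert_subset_insert
        ((subset_insert _ _).trans (subset_insert _ _)))
    exact h3 h2
  · by_contra hne
    refine h.notMem_insert x hx y hy hne ?_
    rw [← hτ x hx, hxy]
    exact hmem y hy

namespace IsParallelConnection

/-- Contracting a flat `F` of `P` acts on `M` like contracting `F ∩ M.E`: if the `N`-part of `F`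
spans `e`, then `e` is already in `F`. -/
lemma closure_union_isFlat (h : IsParallelConnection P M N e) (hN : IsSimple N) {F A : Set α}
    (hF : P.IsFlat F) (hA : A ⊆ M.E) :
    P.closure (A ∪ F) ∩ M.E = M.closure (A ∪ (F ∩ M.E)) := by
  refine subset_antisymm ?_ ?_
  · set Z := M.closure (A ∪ (F ∩ M.E)) with hZ
    have hZE : Z ⊆ M.E := M.closure_subset_ground _
    have hAZ : A ∪ (F ∩ M.E) ⊆ Z := M.subset_closure _ (union_subset hA inter_subset_right)
    have hFE := (h.isFlat_iff F).1 hF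
    have heM := h.mem_left
    have heN := h.mem_right
    have huniq : ∀ x, x ∈ M.E → x ∈ N.E → x = e := fun x ↦ h.eq_base
    have key : ∃ G, P.IsFlat G ∧ A ∪ F ⊆ G ∧ G ∩ M.E = Z := by
      by_cases heZ : e ∈ Z
      · have h1 : (Z ∪ N.E) ∩ M.E = Z := by
          ext x
          have := @hZE x
          have := huniq x
          grind
        refine ⟨Z ∪ N.E, (h.isFlat_iff _).2 ⟨union_subset_union_left _ hZE, ?_, ?_⟩, ?_, h1⟩
        · rw [h1]
          exact M.isFlat_closure _
        · rw [inter_eq_right.2 subset_union_right]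
          exact N.ground_isFlat
        · intro x hx
          have := @hAZ x
          have := @hFE.1 x
          grind
      · have h1 : (Z ∪ (F ∩ N.E)) ∩ M.E = Z := by
          ext x
          have := @hZE x
          have := huniq x
          have := @hAZ x
          grind
        have h2 : (Z ∪ (F ∩ N.E)) ∩ N.E = F ∩ N.E := by
          ext x
          have := @hZE x
          have := huniq x
          grind
        refine ⟨Z ∪ (F ∩ N.E), (h.isFlat_iff _).2 ⟨union_subset_union hZE inter_subset_right,
          ?_, ?_⟩, ?_, h1⟩
        · rw [h1]
          exact M.isFlat_closure _
        · rw [h2]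
          exact hFE.2.2
        · intro x hx
          have := @hAZ x
          have := @hFE.1 x
          grind
    obtain ⟨G, hG, hAG, hGZ⟩ := key
    have h3 := P.closure_subset_closure hAG
    rw [hG.closure] at h3
    rw [← hGZ]
    exact inter_subset_inter_left _ h3
  · rw [← h.closure_left hN (union_subset hA inter_subset_right)]
    exact inter_subset_inter_left _
      (P.closure_subset_closure (union_subset_union_right _ inter_subset_left))

lemma lineOver_left (h : IsParallelConnection P M N e) (hN : IsSimple N) {F S : Set α}
    (hF : P.IsFlat F) (hS : LineOver P F S) (hSM : S ⊆ M.E) : LineOver M (F ∩ M.E) S := by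
  have key : ∀ A ⊆ M.E, ∀ x ∈ M.E, x ∈ P.closure (A ∪ F) ↔ x ∈ M.closure (A ∪ (F ∩ M.E)) := by
    intro A hA x hx
    rw [← h.closure_union_isFlat hN hF hA]
    exact ⟨fun h ↦ ⟨h, hx⟩, fun h ↦ h.1⟩
  refine ⟨hSM, fun x hx hc ↦ hS.notMem x hx ?_, fun x hx y hy hxy hc ↦
    hS.notMem_insert x hx y hy hxy ?_, fun x hx y hy hxy z hz ↦ ?_⟩
  · simpa using (key ∅ (empty_subset _) x (hSM hx)).2 (by simpa using hc)
  · simpa using (key {x} (by simpa using hSM hx) y (hSM hy)).2 (by simpa using hc)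
  · have := (key {x, y} (insert_subset (hSM hx) (singleton_subset_iff.2 (hSM hy))) z (hSM hz)).1
      (by simpa [insert_union] using hS.subset_closure x hx y hy hxy hz)
    simpa [insert_union] using this

/-- A line `S` over a flat `F` either has representatives in `M`, or has `F ⊆ M.E` and two elements
outside `M`. In the latter case at most one element of `S` is in `M`, and `N` contributes at most
`ℓ` others. -/
lemma not_hasUniformTwoMinor (h : IsParallelConnection P M N e) (hM : IsSimple M) (hℓ : 1 ≤ ℓ)
    (hN : IsUniformTwo N (ℓ + 1)) (hMU : ¬ HasUniformTwoMinor M (ℓ + 2)) :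
    ¬ HasUniformTwoMinor P (ℓ + 2) := by
  intro hU
  obtain ⟨W, S, hScard, hWS⟩ := hU.exists_lineOver
  have hNs := hN.isSimple
  have hS := hWS.closure
  set F := P.closure W
  have hF : P.IsFlat F := P.isFlat_closure W
  have hcl := hF.closure
  have hFE := hF.subset_ground
  have heM := h.mem_left
  have heN := h.mem_right
  have hePE := h.left_subset heM
  have hclN : ∀ {x y : α} {Z : Set α}, x ∈ N.E → y ∈ N.E → x ≠ y → x ∈ P.closure Z →
      y ∈ P.closure Z → N.E ⊆ P.closure Z := fun hx hy hxy hxZ hyZ ↦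
    (h.right_subset_closure_pair hM hN hx hy hxy).trans
      (P.closure_subset_closure_of_subset_closure (insert_subset hxZ (singleton_subset_iff.2 hyZ)))
  -- it suffices to move the line into `M`
  have hmove : ∀ τ : α → α, (∀ x ∈ S, τ x ∈ M.E) →
      (∀ x ∈ S, P.closure (insert (τ x) F) = P.closure (insert x F)) → False := by
    intro τ hτM hτ
    obtain ⟨h1, h2⟩ := hS.image (fun x hx ↦ h.left_subset (hτM x hx)) hτ
    have h3 := h.lineOver_left hNs hF h1 (by rintro _ ⟨x, hx, rfl⟩; exact hτM x hx)
    exact hMU (h3.hasUniformTwoMinor (by rw [h2.encard_image, hScard]) inter_subset_right)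
  by_cases hSM : S ⊆ M.E
  · exact hmove id hSM fun _ _ ↦ rfl
  by_cases hFM : F ⊆ M.E
  · obtain ⟨y, hy, hyM⟩ := not_subset.1 hSM
    have hyN : y ∈ N.E := (h.ground_eq.subset (hS.subset hy)).resolve_left hyM
    have hMF := (h.isFlat_left hNs).closure
    -- at most one element of `S` is in `M`, or else the line is contained in `M`
    have hS2 : ∃ z ∈ S, z ≠ y ∧ z ∉ M.E := by
      by_contra! hcon
      have h1 : 1 < (S \ {y}).encard := by
        have := encard_sdiff_singleton_add_one hy
        rw [hScard] at this
        have h2 : (S \ {y}).encard = (ℓ + 1 : ℕ) := by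
          push_cast at this ⊢
          rw [← one_add_one_eq_two, ← add_assoc] at this
          exact ENat.add_right_injective_of_ne_top (n := 1) (by decide)
            (by simpa [add_comm] using this)
        rw [h2]
        norm_cast
        omega
      obtain ⟨s, hs, t, ht, hst⟩ := one_lt_encard_iff_nontrivial.1 h1
      have h2 := hS.subset_closure s hs.1 t ht.1 hst hy
      have h3 := P.closure_subset_closure (insert_subset (hcon s hs.1 hs.2)
        (insert_subset (hcon t ht.1 ht.2) hFM)) h2
      rw [hMF] at h3
      exact hyM h3
    obtain ⟨z, hz, hzy, hzM⟩ := hS2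
    have hzN : z ∈ N.E := (h.ground_eq.subset (hS.subset hz)).resolve_left hzM
    have hye : y ≠ e := fun h ↦ hyM (h ▸ heM)
    have hyE := hS.subset hy
    have heF : e ∉ F := by
      intro heF
      refine hS.notMem_insert y hy z hz hzy.symm ?_
      exact hclN hyN heN hye (P.mem_closure_of_mem' (by simp) hyE)
        (P.mem_closure_of_mem' (by simp [heF]) hePE) hzN
    have hFr := (h.isFlat_iff F).1 hF
    -- The line spanned over `F` by `y` and `z` meets `M` only in the parallel class of `e`, so two
    -- elements of `S` in `M` would be parallel over `F`.
    have h1 : ∀ s ∈ S, s ∈ M.E → s ∈ P.closure (insert e F) := by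
      intro s hs hsM
      have h2 := hS.subset_closure y hy z hz hzy.symm hs
      set Z := P.closure (insert e F) ∩ M.E with hZ
      have hZM : Z ⊆ M.E := inter_subset_right
      have heZ : e ∈ Z := ⟨P.mem_closure_of_mem' (by simp) hePE, heM⟩
      have hG : P.IsFlat (Z ∪ N.E) := by
        have huniq : ∀ x, x ∈ M.E → x ∈ N.E → x = e := fun x ↦ h.eq_base
        have h3 : (Z ∪ N.E) ∩ M.E = Z := by
          ext x
          have := @hZM x
          have := huniq x
          grind
        rw [h.isFlat_iff, h3, inter_eq_right.2 subset_union_right]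
        refine ⟨union_subset_union_left _ hZM, ?_, N.ground_isFlat⟩
        exact ((h.isFlat_iff _).1 (P.isFlat_closure (insert e F))).2.1
      have h3 : insert y (insert z F) ⊆ Z ∪ N.E := by
        refine insert_subset (Or.inr hyN) (insert_subset (Or.inr hzN) fun x hx ↦ Or.inl ⟨?_, hFM hx⟩)
        exact P.mem_closure_of_mem' (Or.inr hx) (hFE hx)
      have h4 := P.closure_subset_closure h3 h2
      rw [hG.closure] at h4
      rcases h4 with h4 | h4
      · exact h4.1
      · rw [h.eq_base hsM h4]
        exact heZ.1
    have h2 : (S ∩ M.E).encard ≤ 1 := by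
      refine encard_le_one_iff.2 fun s t hs ht ↦ ?_
      by_contra hst
      refine hS.notMem_insert s hs.1 t ht.1 hst ?_
      rw [closure_insert_congr ⟨h1 s hs.1 hs.2, hS.notMem s hs.1⟩]
      exact h1 t ht.1 ht.2
    have h3 : S ⊆ (S ∩ M.E) ∪ (N.E \ {e}) := by
      intro s hs
      rcases h.ground_eq.subset (hS.subset hs) with h4 | h4
      · exact Or.inl ⟨hs, h4⟩
      · by_cases hse : s = e
        · exact Or.inl ⟨hs, hse ▸ heM⟩
        · exact Or.inr ⟨h4, hse⟩
    have h4 := (encard_le_encard h3).trans (encard_union_le _ _)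
    have h5 := encard_sdiff_singleton_add_one heN
    have h6 := h4.trans (add_le_add_left h2 _)
    rw [add_comm, h5, hN.1, hScard] at h6
    have : ℓ + 2 ≤ ℓ + 1 := by exact_mod_cast h6
    omega
  -- With an element of `N.E \ {e}` in `F`, every element of `S` outside `M` is parallel to `e` over
  -- `F` and can be replaced by `e`.
  · obtain ⟨y, hyF, hyM⟩ := not_subset.1 hFM
    have hyN : y ∈ N.E := (h.ground_eq.subset (hFE hyF)).resolve_left hyM
    have hye : y ≠ e := fun h ↦ hyM (h ▸ heM)
    classical
    refine hmove (fun x ↦ if x ∈ M.E then x else e) (fun x _ ↦ ?_) fun x hx ↦ ?_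
    · split_ifs with hxM
      · exact hxM
      · exact heM
    · split_ifs with hxM
      · rfl
      have hxE := hS.subset hx
      have hxN : x ∈ N.E := (h.ground_eq.subset hxE).resolve_left hxM
      have hxy : x ≠ y := fun hxy ↦ hS.notMem x hx (hcl.symm ▸ hxy ▸ hyF)
      have hyZ : ∀ u, y ∈ P.closure (insert u F) := fun u ↦
        P.mem_closure_of_mem' (Or.inr hyF) (hFE hyF)
      have hFZ : ∀ u, F ⊆ P.closure (insert u F) := fun u t ht ↦
        P.mem_closure_of_mem' (Or.inr ht) (hFE ht)
      refine subset_antisymm (P.closure_subset_closure_of_subset_closure (insert_subset ?_ (hFZ x)))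
        (P.closure_subset_closure_of_subset_closure (insert_subset ?_ (hFZ e)))
      · exact hclN hxN hyN hxy (P.mem_closure_of_mem' (by simp) hxE) (hyZ x) heN
      · exact hclN heN hyN hye.symm (P.mem_closure_of_mem' (by simp) hePE) (hyZ e) hxN

end IsParallelConnection

lemma IsUniformTwo.not_hasUniformTwoMinor (h : IsUniformTwo M (ℓ + 1)) :
    ¬ HasUniformTwoMinor M (ℓ + 2) := by
  rintro ⟨N, hNM, hN⟩
  have h1 := encard_le_encard hNM.subset
  rw [hN.1, h.1] at h1
  have : ℓ + 2 ≤ ℓ + 1 := by exact_mod_cast h1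
  omega

lemma IsParallelConnectionOfLines.not_hasUniformTwoMinor
    (h : IsParallelConnectionOfLines ℓ r M) (hℓ : 1 ≤ ℓ) : ¬ HasUniformTwoMinor M (ℓ + 2) := by
  induction h with
  | line hM => exact hM.not_hasUniformTwoMinor
  | connect hM hN hP ih => exact hP.not_hasUniformTwoMinor hM.isSimple hℓ hN ih

/-! ### Representing parallel connections -/

lemma exists_matroid_indep_iff {E : Set α} (hE : E.Finite) (v : α → Fin k → ℝ) :
    ∃ Q : Matroid α, Q.E = E ∧ ∀ I ⊆ E, (Q.Indep I ↔ LinearIndepOn ℝ v I) := by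
  have hfinrank : ∀ I ⊆ E, LinearIndepOn ℝ v I →
      Module.finrank ℝ (Submodule.span ℝ (v '' I)) = I.ncard := by
    intro I hIE hI
    have := (hE.subset hIE).fintype
    rw [image_eq_range, finrank_span_eq_card hI, ← Nat.card_coe_set_eq, Nat.card_eq_fintype_card]
  refine ⟨(IndepMatroid.ofFinite hE (fun I ↦ I ⊆ E ∧ LinearIndepOn ℝ v I) ⟨empty_subset _,
    linearIndepOn_empty ℝ v⟩ (fun I J hJ hIJ ↦ ⟨hIJ.trans hJ.1, hJ.2.mono hIJ⟩) ?_
    fun I hI ↦ hI.1).matroid, rfl, fun I hI ↦ ?_⟩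
  · rintro I J ⟨hIE, hI⟩ ⟨hJE, hJ⟩ hlt
    by_contra! hcon
    refine hlt.not_ge ?_
    rw [← hfinrank I hIE hI, ← hfinrank J hJE hJ]
    refine Submodule.finrank_mono (Submodule.span_le.2 ?_)
    rintro _ ⟨x, hx, rfl⟩
    by_cases hxI : x ∈ I
    · exact Submodule.subset_span (mem_image_of_mem v hxI)
    by_contra hxs
    exact hcon x hx hxI (insert_subset (hJE hx) hIE) ((linearIndepOn_insert hxI).2 ⟨hI, hxs⟩)
  · exact and_iff_right hI

/-- The linear map that adds a zero coordinate in front. -/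
def consZero (k : ℕ) : (Fin k → ℝ) →ₗ[ℝ] (Fin (k + 1) → ℝ) where
  toFun x := Matrix.vecCons 0 x
  map_add' x y := by simp
  map_smul' c x := by simp

lemma ker_consZero : (consZero k).ker = ⊥ := by
  refine LinearMap.ker_eq_bot.2 fun x y hxy ↦ ?_
  ext i
  exact congrFun hxy i.succ

/-- Representing a parallel connection with a line: the elements of the line different from the
base point go to a pencil through the vector of the base point. -/
lemma IsParallelConnection.indep_iff_linearIndepOn (hP : IsParallelConnection P M N e)
    (hM : IsSimple M) (hMfin : M.E.Finite) (hN : IsUniformTwo N n) {v' : α → Fin (k + 1) → ℝ}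
    {w : α → ℝˣ} {ι : α → ℝ} (hι : InjOn ι N.E) (hιe : ι e = 0)
    (hv : ∀ I ⊆ M.E, (M.Indep I ↔ LinearIndepOn ℝ v I))
    (hvM : ∀ x ∈ M.E, v' x = Matrix.vecCons 0 (w x • v x))
    (hvN : ∀ x ∈ N.E, v' x = Matrix.vecCons (ι x) (-v e)) :
    ∀ I ⊆ P.E, (P.Indep I ↔ LinearIndepOn ℝ v' I) := by
  have hNfin : N.E.Finite := finite_of_encard_eq_coe hN.1
  have hPfin : P.E.Finite := hP.ground_eq ▸ hMfin.union hNfin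
  -- The matroid `Q` of the vectors `v'` restricts to `M` and to `N`, and `M.E` is a flat of it
  -- because the first coordinate vanishes there and nowhere else. The recognition criterion and
  -- uniqueness of parallel connections give `Q = P`.
  obtain ⟨Q, hQE, hQ⟩ := exists_matroid_indep_iff hPfin v'
  have heM := hP.mem_left
  have heN := hP.mem_right
  have hve : v e ≠ 0 := by
    have := (hv {e} (by simpa)).1 (by simpa using hM e heM e heM)
    simpa using this
  have hQM : Q ↾ M.E = M := by
    refine ext_indep rfl fun I hI ↦ ?_
    have hI : I ⊆ M.E := hI
    rw [restrict_indep_iff, and_iff_left hI, hQ I (hI.trans hP.left_subset), hv I hI,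
      ← linearIndepOn_units_smul w v]
    rw [linearIndepOn_congr (w := fun x ↦ consZero k (w x • v x)) fun x hx ↦ hvM x (hI hx)]
    exact (consZero k).linearIndependent_iff (v := fun x : I ↦ w x • v x) ker_consZero
  have hpair : ∀ x ∈ N.E, ∀ y ∈ N.E, x ≠ y → LinearIndepOn ℝ v' {x, y} := by
    intro x hx y hy hxy
    rw [LinearIndepOn.pair_iff _ hxy, hvN x hx, hvN y hy]
    intro s t hst
    obtain ⟨i, hi⟩ := Function.ne_iff.1 hve
    have h0 := congrFun hst 0
    have h1 := congrFun hst i.succ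
    simp only [Pi.add_apply, Pi.smul_apply, Matrix.cons_val_zero, Matrix.cons_val_succ,
      Pi.neg_apply, smul_eq_mul, Pi.zero_apply] at h0 h1 hi
    have h2 : s + t = 0 := by
      have : (s + t) * v e i = 0 := by linarith
      exact (mul_eq_zero.1 this).resolve_right hi
    have h3 : s * (ι x - ι y) = 0 := by
      rw [eq_neg_of_add_eq_zero_right h2] at h0
      linarith
    have h4 : s = 0 := (mul_eq_zero.1 h3).resolve_right (sub_ne_zero.2 fun h ↦ hxy (hι hx hy h))
    exact ⟨h4, by linarith⟩
  have hcl : ∀ x ∈ N.E, ∀ y ∈ N.E, x ≠ y → N.E ⊆ Q.closure {x, y} := by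
    intro x hx y hy hxy z hz
    have hsub : N.E ⊆ Q.E := hQE ▸ hP.right_subset
    rw [mem_closure_iff_mem_span (fun I hI ↦ hQ I (hQE ▸ hI))
      (insert_subset (hsub hx) (singleton_subset_iff.2 (hsub hy))) (hsub hz), image_pair,
      Submodule.mem_span_pair]
    have h1 : ι y - ι x ≠ 0 := sub_ne_zero.2 fun h ↦ hxy (hι hx hy h.symm)
    refine ⟨(ι y - ι z) / (ι y - ι x), (ι z - ι x) / (ι y - ι x), ?_⟩
    rw [hvN x hx, hvN y hy, hvN z hz]
    ext i
    refine Fin.cases ?_ (fun i ↦ ?_) i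
    · simp only [Pi.add_apply, Pi.smul_apply, Matrix.cons_val_zero, smul_eq_mul]
      field_simp
      ring
    · simp only [Pi.add_apply, Pi.smul_apply, Matrix.cons_val_succ, smul_eq_mul, Pi.neg_apply]
      field_simp
      ring
  have hQN : Q ↾ N.E = N := by
    refine ext_indep rfl fun I hI ↦ ?_
    have hI : I ⊆ N.E := hI
    have hIfin := hNfin.subset hI
    rw [restrict_indep_iff, and_iff_left hI, hN.2, and_iff_right hI]
    constructor
    · intro hQI
      by_contra! hcard
      rw [← hIfin.cast_ncard_eq] at hcard
      obtain ⟨x, y, z, hx, hy, hz, hxy, hxz, hyz⟩ :=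
        (two_lt_ncard_iff hIfin).1 (by exact_mod_cast hcard)
      have h1 := hQI.notMem_closure_sdiff_of_mem hz
      refine h1 (Q.closure_subset_closure ?_ (hcl x (hI hx) y (hI hy) hxy (hI hz)))
      rintro _ (rfl | rfl)
      · exact ⟨hx, hxz⟩
      · exact ⟨hy, hyz⟩
    · intro hcard
      rw [hQ I (hI.trans hP.right_subset)]
      by_cases hpr : ∃ x ∈ I, ∃ y ∈ I, x ≠ y
      · obtain ⟨x, hx, y, hy, hxy⟩ := hpr
        have h1 : {x, y} = I := by
          refine (toFinite {x, y}).eq_of_subset_of_encard_le (insert_subset hx (singleton_subset_iff.2 hy)) ?_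
          rwa [encard_pair hxy]
        rw [← h1]
        exact hpair x (hI hx) y (hI hy) hxy
      · push Not at hpr
        rcases I.eq_empty_or_nonempty with rfl | ⟨x, hx⟩
        · exact linearIndepOn_empty ℝ v'
        · have h1 : I = {x} := subset_antisymm (fun y hy ↦ hpr y hy x hx)
            (singleton_subset_iff.2 hx)
          rw [h1]
          have h2 : v' x ≠ 0 := by
            rw [hvN x (hI hx)]
            intro h
            refine hve ?_
            ext i
            have := congrFun h i.succ
            simpa using this
          simpa using h2
  have hflat : Q.IsFlat M.E := by
    have hMQ : M.E ⊆ Q.E := hQE ▸ hP.left_subset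
    rw [isFlat_iff_closure_eq]
    refine subset_antisymm (fun x hx ↦ ?_) (Q.subset_closure _ hMQ)
    have hxE := mem_ground_of_mem_closure hx
    rw [mem_closure_iff_mem_span (fun I hI ↦ hQ I (hQE ▸ hI)) hMQ hxE] at hx
    by_contra hxM
    have hxN : x ∈ N.E := (hP.ground_eq.subset (hQE ▸ hxE)).resolve_left hxM
    have h1 : Submodule.span ℝ (v' '' M.E) ≤ (LinearMap.proj (R := ℝ) (0 : Fin (k + 1))).ker := by
      rw [Submodule.span_le]
      rintro _ ⟨y, hy, rfl⟩
      rw [hvM y hy]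
      simp
    have h2 := h1 hx
    rw [hvN x hxN] at h2
    have h3 : ι x = 0 := by simpa using h2
    exact hxM (hι hxN heN (h3.trans hιe.symm) ▸ heM)
  have h1 := isParallelConnection_restrict (M := Q) (hQE.symm ▸ hP.ground_eq.symm)
    hP.inter_ground hflat hcl
  rw [hQM, hQN] at h1
  rw [hP.unique h1]
  exact fun I hI ↦ hQ I (hQE ▸ hI)

lemma span_consZero_union {E : Set α} {v' : α → Fin (k + 1) → ℝ} {w : α → ℝˣ}
    (hv : Submodule.span ℝ (v '' E) = ⊤) (hv' : ∀ x ∈ E, v' x = Matrix.vecCons 0 (w x • v x))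
    {F : Set α} (hEF : E ⊆ F) (hy : y ∈ F) (hy0 : v' y 0 ≠ 0) :
    Submodule.span ℝ (v' '' F) = ⊤ := by
  have h1 : ∀ u : Fin k → ℝ, Matrix.vecCons 0 u ∈ Submodule.span ℝ (v' '' F) := by
    intro u
    have hu : u ∈ Submodule.span ℝ ((fun x ↦ w x • v x) '' E) := by
      rw [span_units_smul, hv]
      trivial
    have h2 := Submodule.mem_map_of_mem (f := consZero k) hu
    rw [Submodule.map_span] at h2
    refine Submodule.span_mono ?_ h2
    rintro _ ⟨_, ⟨x, hx, rfl⟩, rfl⟩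
    exact ⟨x, hEF hx, hv' x hx⟩
  rw [eq_top_iff]
  intro x _
  have h2 : x = (x 0 / v' y 0) • v' y +
      Matrix.vecCons 0 (fun i ↦ x i.succ - x 0 / v' y 0 * v' y i.succ) := by
    ext i
    refine Fin.cases ?_ (fun i ↦ ?_) i <;> simp [hy0]
  rw [h2]
  exact add_mem (Submodule.smul_mem _ _ (Submodule.subset_span (mem_image_of_mem v' hy))) (h1 _)

lemma det_vecCons_consZero (c : ℝ) (u : Fin k → ℝ) (w : Fin k → Fin k → ℝ) :
    (Matrix.of (Matrix.vecCons (Matrix.vecCons c u) fun j ↦ Matrix.vecCons 0 (w j))).det =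
      c * (Matrix.of w).det := by
  rw [Matrix.det_succ_column_zero, Fin.sum_univ_succ, Finset.sum_eq_zero, add_zero]
  · simp only [Matrix.of_apply, Matrix.cons_val_zero, Fin.val_zero, pow_zero, one_mul]
    rfl
  · intro i _
    simp

/-- Subtracting the second row from the first leaves `a - b` in the first column and zeros
elsewhere. -/
lemma det_vecCons_vecCons_of_tail_eq (a b : ℝ) (u : Fin (k + 1) → ℝ) (c : Fin k → ℝ)
    (w : Fin k → Fin (k + 1) → ℝ) :
    (Matrix.of (Matrix.vecCons (Matrix.vecCons a u) (Matrix.vecCons (Matrix.vecCons b u)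
      fun j ↦ Matrix.vecCons (c j) (w j)))).det = (a - b) * (Matrix.of (Matrix.vecCons u w)).det := by
  rw [det_vecCons_eq_smul (lam := a - b) (y := Matrix.vecCons 1 0)]
  · congr 1
    rw [Matrix.det_succ_row_zero, Fin.sum_univ_succ, Finset.sum_eq_zero, add_zero]
    · simp only [Matrix.of_apply, Matrix.cons_val_zero, Fin.val_zero, pow_zero, one_mul]
      congr 1
      ext i j
      refine Fin.cases ?_ (fun i ↦ ?_) i <;> simp
    · intro i _
      simp
  · refine Submodule.subset_span ⟨0, ?_⟩
    ext i
    refine Fin.cases ?_ (fun i ↦ ?_) i <;> simp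

lemma exists_comp_perm_eq_vecCons (s : Fin (k + 1) → α) (i : Fin (k + 1)) :
    ∃ (σ : Equiv.Perm (Fin (k + 1))) (s' : Fin k → α), s ∘ σ = Matrix.vecCons (s i) s' ∧
      range s' ⊆ range s := by
  refine ⟨Equiv.swap 0 i, fun j ↦ s (Equiv.swap 0 i j.succ), ?_, ?_⟩
  · ext j
    refine Fin.cases ?_ (fun j ↦ ?_) j <;> simp
  · rintro _ ⟨j, rfl⟩
    exact mem_range_self _

lemma vecCons_comp_perm (x : α) (s : Fin k → α) (τ : Equiv.Perm (Fin k)) :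
    ∃ σ : Equiv.Perm (Fin (k + 1)), Matrix.vecCons x s ∘ σ = Matrix.vecCons x (s ∘ τ) := by
  refine ⟨Equiv.Perm.decomposeFin.symm (0, τ), ?_⟩
  ext j
  refine Fin.cases ?_ (fun j ↦ ?_) j <;> simp

/-- A minor depends on its number of new elements: with none it vanishes, with one it reduces to a
minor of `M`, with two to a minor of `M` through `e`, and with three or more it vanishes again. -/
lemma PosRep.parallel (h : PosRep M k pos v) (hM : IsSimple M) (hMfin : M.E.Finite)
    (hN : IsUniformTwo N (ℓ + 1)) (hℓ : 1 ≤ ℓ) (hP : IsParallelConnection P M N e) :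
    ∃ pos' v', PosRep P (k + 1) pos' v' := by
  classical
  have hNfin : N.E.Finite := finite_of_encard_eq_coe hN.1
  have heM := hP.mem_left
  have heN := hP.mem_right
  -- positions of the new elements, right after the base point
  obtain ⟨ι, B, hι, hιe, hιpos, hιB⟩ : ∃ (ι : α → ℤ) (B : ℤ), InjOn ι N.E ∧ ι e = 0 ∧
      (∀ y, y ≠ e → 0 < ι y) ∧ ∀ y ∈ N.E, ι y < B := by
    obtain ⟨g, hg⟩ := countable_iff_exists_injOn.1 hNfin.countable
    let ι : α → ℤ := fun x ↦ if x = e then 0 else g x + 1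
    obtain ⟨B, hB⟩ := (hNfin.image ι).bddAbove
    refine ⟨ι, B + 1, fun x hx y hy hxy ↦ ?_, by simp [ι], fun y hy ↦ ?_, fun y hy ↦
      Int.lt_add_one_of_le (hB (mem_image_of_mem ι hy))⟩
    · simp only [ι] at hxy
      split_ifs at hxy with h1 h2 h2
      · rw [h1, h2]
      · omega
      · omega
      · exact hg hx hy (by omega)
    · simp only [ι, if_neg hy]
      omega
  have hB : 0 < B := hιe ▸ hιB e heN
  -- The sign of `x` relative to a new element, which sits just after `e`. So `e` itself gets `-1`,
  -- and the two formulas for `v'` agree at `e`, where `ι` is `0`.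
  let w : α → ℝˣ := fun x ↦ if pos e < pos x then 1 else -1
  let pos' : α → ℤ := fun x ↦ if x ∈ M.E then B * pos x else B * pos e + ι x
  let v' : α → Fin (k + 1) → ℝ := fun x ↦
    if x ∈ M.E then Matrix.vecCons 0 (w x • v x) else Matrix.vecCons (ι x : ℝ) (-v e)
  have huniq : ∀ x ∈ N.E, x ∈ M.E → x = e := fun x hxN hxM ↦ hP.eq_base hxM hxN
  have hwe : w e = -1 := by simp [w]
  have hpM : ∀ x ∈ M.E, pos' x = B * pos x := fun x hx ↦ if_pos hx
  have hpN : ∀ x ∈ N.E, pos' x = B * pos e + ι x := by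
    intro x hx
    by_cases hxM : x ∈ M.E
    · obtain rfl := huniq x hx hxM
      rw [hpM x hxM, hιe, add_zero]
    · exact if_neg hxM
  have hvM : ∀ x ∈ M.E, v' x = Matrix.vecCons 0 (w x • v x) := fun x hx ↦ if_pos hx
  have hvN : ∀ x ∈ N.E, v' x = Matrix.vecCons (ι x : ℝ) (-v e) := by
    intro x hx
    by_cases hxM : x ∈ M.E
    · obtain rfl := huniq x hx hxM
      rw [hvM x hxM, hιe, hwe]
      simp
    · exact if_neg hxM
  -- the signs of the differences of positions
  have hsign : ∀ x ∈ M.E, ∀ y ∈ N.E, y ≠ e → 0 < ((pos' x : ℝ) - pos' y) * w x := by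
    intro x hx y hy hye
    rw [hpM x hx, hpN y hy]
    have h1 := hιpos y hye
    have h2 := hιB y hy
    by_cases hlt : pos e < pos x
    · have : 0 < B * pos x - (B * pos e + ι y) := by nlinarith
      have : (0 : ℝ) < ((B * pos x : ℤ) : ℝ) - (B * pos e + ι y : ℤ) := by exact_mod_cast this
      simpa [w, hlt] using this
    · have : B * pos x - (B * pos e + ι y) < 0 := by nlinarith
      have : ((B * pos x : ℤ) : ℝ) - (B * pos e + ι y : ℤ) < 0 := by exact_mod_cast this
      simp only [w, if_neg hlt, Units.val_neg, Units.val_one]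
      linarith
  have hsign' : ∀ x ∈ M.E, x ≠ e → 0 < ((pos x : ℝ) - pos e) * w x := by
    intro x hx hxe
    by_cases hlt : pos e < pos x
    · simp [w, hlt]
    · have : pos x < pos e := lt_of_le_of_ne (not_lt.1 hlt) fun h1 ↦ hxe (h.injOn hx heM h1)
      have : (pos x : ℝ) < pos e := by exact_mod_cast this
      simp only [w, if_neg hlt, Units.val_neg, Units.val_one]
      linarith
  have hPE : ∀ x ∈ P.E, x ∈ M.E ∨ x ∈ N.E ∧ x ≠ e := by
    intro x hx
    rcases hP.ground_eq.subset hx with h1 | h1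
    · exact Or.inl h1
    · by_cases hxe : x = e
      · exact Or.inl (hxe ▸ heM)
      · exact Or.inr ⟨h1, hxe⟩
  have hcross : ∀ x ∈ M.E, ∀ y ∈ N.E, y ≠ e → pos' x ≠ pos' y := by
    intro x hx y hy hye hxy
    have := hsign x hx y hy hye
    simp [hxy] at this
  obtain ⟨δ, hδ, hnn⟩ := h.nonneg
  obtain ⟨y₀, hy₀, hy₀e⟩ := hN.exists_ne hℓ e
  refine ⟨pos', v', ?_, hP.indep_iff_linearIndepOn hM hMfin hN (ι := fun x ↦ (ι x : ℝ)) (w := w)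
    (Int.cast_injective.injOn.comp hι fun _ _ ↦ mem_univ _) (by simp [hιe]) h.indep_iff hvM hvN,
    span_consZero_union h.span_eq hvM hP.left_subset (hP.right_subset hy₀) ?_,
    δ, hδ, fun s hs ↦ ?_⟩
  · intro x hx y hy hxy
    rcases hPE x hx with hxM | ⟨hxN, hxe⟩ <;> rcases hPE y hy with hyM | ⟨hyN, hye⟩
    · rw [hpM x hxM, hpM y hyM] at hxy
      exact h.injOn hxM hyM (mul_left_cancel₀ hB.ne' hxy)
    · exact absurd hxy (hcross x hxM y hyN hye)
    · exact absurd hxy.symm (hcross y hyM x hxN hxe)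
    · rw [hpN x hxN, hpN y hyN] at hxy
      exact hι hxN hyN (add_left_cancel hxy)
  · rw [hvN y₀ hy₀]
    simp [(hιpos y₀ hy₀e).ne']
  -- nonnegativity of the minors
  have hpκ : ∀ m, ∃ κ : ℝ, 0 < κ ∧ ∀ s : Fin m → α, (∀ i, s i ∈ M.E) →
      vdm (pos' ∘ s) = κ * vdm (pos ∘ s) := by
    intro m
    obtain ⟨κ, hκ, h1⟩ := exists_vdm_mul B hB m
    refine ⟨κ, hκ, fun s hs ↦ ?_⟩
    rw [← h1]
    congr 1
    ext i
    exact hpM _ (hs i)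
  by_cases hsM : ∀ i, s i ∈ M.E
  · rw [Matrix.det_eq_zero_of_column_eq_zero 0, mul_zero, mul_zero]
    intro i
    simp [hvM _ (hsM i)]
  push Not at hsM
  obtain ⟨i, hi⟩ := hsM
  obtain ⟨σ, s', hσ, hs'⟩ := exists_comp_perm_eq_vecCons s i
  have hs'P : ∀ j, s' j ∈ P.E := fun j ↦ by
    obtain ⟨j', hj'⟩ := hs' (mem_range_self j)
    exact hj' ▸ hs j'
  rw [← vdm_mul_det_comp_perm _ _ _ σ, hσ]
  obtain ⟨hyN, hye⟩ := (hPE _ (hs i)).resolve_left hi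
  generalize s i = y at hyN hye
  clear! s
  by_cases hsM : ∀ j, s' j ∈ M.E
  · obtain ⟨κ, hκ, hvdm⟩ := hpκ k
    have h1 : v' ∘ s' = fun j ↦ Matrix.vecCons 0 (w (s' j) • v (s' j)) :=
      funext fun j ↦ hvM _ (hsM j)
    rw [comp_vecCons, comp_vecCons, vdm_vecCons, hvdm s' hsM, h1, hvN y hyN, det_vecCons_consZero,
      det_units_smul]
    have h2 : 0 < ∏ j, (((pos' (s' j) : ℝ) - pos' y) * w (s' j)) :=
      Finset.prod_pos fun j _ ↦ hsign _ (hsM j) y hyN hye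
    rw [Finset.prod_mul_distrib] at h2
    have h3 := hnn s' hsM
    have h4 : (0 : ℝ) < ι y := by exact_mod_cast hιpos y hye
    have h5 := mul_nonneg (mul_pos (mul_pos h2 hκ) h4).le h3
    convert! h5 using 1
    simp only [Function.comp_apply, Function.comp_def]
    ring
  push Not at hsM
  obtain ⟨j, hj⟩ := hsM
  obtain ⟨m, rfl⟩ : ∃ m, k = m + 1 := ⟨k - 1, by have := j.2; omega⟩
  obtain ⟨τ, s, hτ, hss⟩ := exists_comp_perm_eq_vecCons s' j
  have hsP : ∀ j, s j ∈ P.E := fun j ↦ by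
    obtain ⟨j', hj'⟩ := hss (mem_range_self j)
    exact hj' ▸ hs'P j'
  obtain ⟨σ, hσ⟩ := vecCons_comp_perm y s' τ
  rw [← vdm_mul_det_comp_perm _ _ _ σ, hσ, hτ]
  obtain ⟨hzN, hze⟩ := (hPE _ (hs'P j)).resolve_left hj
  generalize s' j = z at hzN hze
  clear! s'
  rw [comp_vecCons, comp_vecCons, comp_vecCons, comp_vecCons, hvN y hyN, hvN z hzN]
  have h1 : v' ∘ s = fun j ↦ Matrix.vecCons (v' (s j) 0) (Matrix.vecTail (v' (s j))) :=
    funext fun j ↦ (Matrix.cons_head_tail _).symm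
  rw [h1, det_vecCons_vecCons_of_tail_eq]
  -- A third new element repeats the row `-v e` once the first coordinate is gone, and so would `e`
  -- itself.
  by_cases hsM : ∀ j, s j ∈ M.E
  swap
  · push Not at hsM
    obtain ⟨j, hj⟩ := hsM
    obtain ⟨hjN, -⟩ := (hPE _ (hsP j)).resolve_left hj
    rw [Matrix.det_zero_of_row_eq (i := 0) (j := j.succ) (Fin.succ_ne_zero j).symm]
    · simp
    · ext i
      simp [hvN _ hjN]
  have h2 : (Matrix.vecCons (-v e) fun j ↦ Matrix.vecTail (v' (s j))) =
      fun i ↦ w (Matrix.vecCons e s i) • v (Matrix.vecCons e s i) := by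
    ext i
    refine Fin.cases ?_ (fun i ↦ ?_) i
    · simp [hwe]
    · simp [hvM _ (hsM i)]
  rw [h2, det_units_smul]
  by_cases hse : ∃ j, s j = e
  · obtain ⟨j, hj⟩ := hse
    rw [Matrix.det_zero_of_row_eq (i := 0) (j := j.succ) (Fin.succ_ne_zero j).symm]
    · simp
    · ext i
      simp [hj]
  push Not at hse
  obtain ⟨κ, hκ, hvdm⟩ := hpκ m
  have h3 := hnn (Matrix.vecCons e s) fun i ↦ Fin.cases heM hsM i
  rw [comp_vecCons, vdm_vecCons] at h3
  rw [vdm_vecCons, vdm_vecCons, hvdm s hsM]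
  simp only [Fin.prod_univ_succ, Matrix.cons_val_zero, Matrix.cons_val_succ, hwe, hpN y hyN,
    hpN z hzN]
  have h4 : 0 < ∏ j, (((pos' (s j) : ℝ) - pos' y) * ((pos' (s j) : ℝ) - pos' z) * w (s j) /
      ((pos (s j) : ℝ) - pos e)) := by
    refine Finset.prod_pos fun j _ ↦ ?_
    have h5 := hsign _ (hsM j) y hyN hye
    have h6 := hsign _ (hsM j) z hzN hze
    have h7 := hsign' _ (hsM j) (hse j)
    have h8 : ((pos (s j) : ℝ) - pos e) ≠ 0 := fun h8 ↦ by simp [h8] at h7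
    have h9 := div_pos (mul_pos h5 h6) h7
    convert! h9 using 1
    field_simp
  rw [Finset.prod_div_distrib, Finset.prod_mul_distrib, Finset.prod_mul_distrib] at h4
  have h5 : ∏ j, ((pos (s j) : ℝ) - pos e) ≠ 0 := fun h5 ↦ by simp [h5] at h4
  -- The square combines the difference of the two new positions, the factor `ι y - ι z` of the
  -- determinant, and the sign `w e = -1`.
  have h6 := mul_nonneg (mul_nonneg (mul_pos h4 hκ).le (sq_nonneg ((ι y : ℝ) - ι z))) h3
  convert! h6 using 1
  simp only [Function.comp_apply, Function.comp_def, hpN y hyN, hpN z hzN]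
  push_cast
  field_simp
  ring

/-- A line is the parallel connection of itself with a single point, so `PosRep.parallel` also
covers the base case. -/
lemma IsUniformTwo.exists_posRep (hM : IsUniformTwo M (ℓ + 1)) (hℓ : 1 ≤ ℓ) :
    ∃ pos v, PosRep M 2 pos v := by
  have hs := hM.isSimple
  obtain ⟨e, he⟩ : M.E.Nonempty := nonempty_of_encard_ne_zero (by rw [hM.1]; simp)
  have hP := isParallelConnection_restrict (M := M) (H := {e}) (K := M.E) (g := e)
    (by simpa using he) (by simpa using he)
    (by rw [← hs.closure_singleton he]; exact M.isFlat_closure _)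
    fun x hx y hy hxy ↦ hM.ground_subset_closure hx hy hxy
  rw [restrict_ground_eq_self] at hP
  have hbase : PosRep (M ↾ {e}) 1 (fun _ ↦ 0) fun _ _ ↦ 1 := by
    refine ⟨by simp, fun I hI ↦ ?_, ?_, 1, one_ne_zero, fun s hs ↦ ?_⟩
    · have hI : I ⊆ {e} := hI
      have h1 : M.Indep {e} := by simpa using hs e he e he
      have h2 : LinearIndepOn ℝ (fun (_ : α) (_ : Fin 1) ↦ (1 : ℝ)) {e} := by
        rw [linearIndepOn_singleton_iff]
        exact fun h ↦ one_ne_zero (congrFun h 0)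
      exact iff_of_true ⟨h1.subset hI, hI⟩ (h2.mono hI)
    · rw [restrict_ground_eq, image_singleton, eq_top_iff]
      intro x _
      refine Submodule.mem_span_singleton.2 ⟨x 0, ?_⟩
      ext i
      rw [Fin.eq_zero i]
      simp
    · simp [vdm]
  exact hbase.parallel (hs.restrict (by simpa using he)) (by simp) hM hℓ hP

lemma IsParallelConnectionOfLines.exists_posRep (h : IsParallelConnectionOfLines ℓ r M)
    (hℓ : 1 ≤ ℓ) : ∃ pos v, PosRep M r pos v := by
  induction h with
  | line hM => exact hM.exists_posRep hℓ
  | connect hM hN hP ih =>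
    obtain ⟨pos, v, h⟩ := ih
    exact h.parallel hM.isSimple hM.finite hN hℓ hP

end PositroidExtremal

theorem theorem1p1 {α : Type*} (r ℓ : ℕ) (hr : 1 ≤ r) (hℓ : 1 ≤ ℓ)
    (M : Matroid α) (hfin : M.Finite) :
    ((PositroidExtremal.IsSimple M ∧ M.eRank = (r : ℕ∞) ∧ PositroidExtremal.IsPositroid M ∧
        ¬ PositroidExtremal.HasUniformTwoMinor M (ℓ + 2)) →
      M.E.ncard ≤ ℓ * (r - 1) + 1) ∧
    (2 ≤ r →
      ((PositroidExtremal.IsSimple M ∧ M.eRank = (r : ℕ∞) ∧ PositroidExtremal.IsPositroid M ∧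
          ¬ PositroidExtremal.HasUniformTwoMinor M (ℓ + 2) ∧
          M.E.ncard = ℓ * (r - 1) + 1) ↔
        PositroidExtremal.IsParallelConnectionOfLines ℓ r M)) := by
  have key : PositroidExtremal.IsSimple M → M.eRank = (r : ℕ∞) → PositroidExtremal.IsPositroid M →
      ¬ PositroidExtremal.HasUniformTwoMinor M (ℓ + 2) →
      PositroidExtremal.Admissible ℓ r M := by
    intro hs hrk hpos hU
    obtain ⟨k, pos, v, h⟩ := hpos.exists_posRep
    obtain rfl : k = r := by exact_mod_cast h.eRank_eq.symm.trans hrk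
    exact ⟨hfin.ground_finite, hs, ⟨pos, v, h⟩, hU⟩
  refine ⟨fun ⟨hs, hrk, hpos, hU⟩ ↦ ?_, fun hr2 ↦
    ⟨fun ⟨hs, hrk, hpos, hU, hcard⟩ ↦ ?_, fun h ↦ ?_⟩⟩
  · obtain ⟨k, rfl⟩ := Nat.exists_eq_add_of_le' hr
    exact (key hs hrk hpos hU).ncard_le
  · obtain ⟨k, rfl⟩ := Nat.exists_eq_add_of_le' hr2
    exact (key hs hrk hpos hU).isParallelConnectionOfLines hcard hℓ
  · obtain ⟨pos, v, hrep⟩ := h.exists_posRep hℓ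
    refine ⟨h.isSimple, h.eRank_eq hℓ, hrep.isPositroid h.finite, h.not_hasUniformTwoMinor hℓ, ?_⟩
    have h1 := h.ncard_add
    obtain ⟨k, rfl⟩ := Nat.exists_eq_add_of_le' hr
    simp only [Nat.add_sub_cancel]
    linarith
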